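/- All graphs are finite and simple. For graphs $G$ and $H$, we say that $G$ is $H$-free if no induced subgraph of $G$ is isomorphic to $H$. A longest path of $G$ is a path of $G$ with the maximum number of edges among all paths of $G$, and a Gallai vertex of $G$ is a vertex that lies on every longest path of $G$. A linear forest is a forest in which every component is a path. Let $H$ be a graph on at most $4$ vertices. Then every connected $H$-free graph has a Gallai vertex if and only if $H$ is a linear forest. -/

import Mathlib

universe u v

namespace GallaiPaths

/-- A longest path of `G`: a path with at least as many edges as every path of `G`
(with arbitrary ends). -/
def IsLongestPath {V : Type u} (G : SimpleGraph V) {a b : V} (p : G.Walk a b) : Prop :=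
  p.IsPath ∧ ∀ (c d : V) (q : G.Walk c d), q.IsPath → q.length ≤ p.length

/-- A Gallai set (longest path transversal): a set of vertices that meets every longest path. -/
def IsGallaiSet {V : Type u} (G : SimpleGraph V) (S : Set V) : Prop :=
  ∀ (a b : V) (p : G.Walk a b), IsLongestPath G p → ∃ x ∈ S, x ∈ p.support

/-- A Gallai vertex: a vertex that lies on every longest path. -/
def IsGallaiVertex {V : Type u} (G : SimpleGraph V) (x : V) : Prop :=
  IsGallaiSet G {x}

/-- `G` is `H`-free: no induced subgraph of `G` is isomorphic to `H`. -/
def IsInducedFree {V : Type u} {W : Type v} (H : SimpleGraph V) (G : SimpleGraph W) : Prop :=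
  ¬ H.IsIndContained G

/-- A fixer: every finite connected `H`-free graph has a Gallai vertex. -/
def IsFixer {V : Type u} (H : SimpleGraph V) : Prop :=
  ∀ (W : Type v) [Finite W] (G : SimpleGraph W),
    G.Connected → IsInducedFree H G → ∃ x : W, IsGallaiVertex G x

/-- A linear forest: a forest in which every component is a path. -/
def IsLinearForest {V : Type u} (H : SimpleGraph V) : Prop :=
  H.IsAcyclic ∧ ∀ c : H.ConnectedComponent,
    ∃ n : ℕ, Nonempty (c.toSimpleGraph ≃g SimpleGraph.pathGraph n)

end GallaiPaths

/-!
A graph on at most four vertices is a linear forest exactly when it contains, as a subgraph, no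
triangle, no 4-cycle and no claw (`HasObstruction`).

*Graphs with an obstruction.* Take a graph with three terminals in which the longest paths between
distinct terminals have `L` vertices and no common vertex, and attach a pendant path to each
terminal. If the pendant paths are long enough, no path of the resulting graph is longer than such
an extremal path extended along two pendant paths (`IsGallaiCore.length_le_attachPaths`), so no
vertex lies on all longest paths. The Petersen graph without one vertex, with the neighbours of that
vertex as terminals, is such a graph because the Petersen graph is hypohamiltonian; the outcome has
girth at least five, so it omits every graph with a triangle or a 4-cycle. Replacing each vertex by
a triangle first makes it claw-free, which settles triangle-free graphs with a claw. The bounds on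
the lengths of paths between terminals come from an exhaustive search (`hasLongPath`).

*Linear forests.* After adding isolated vertices, a linear forest on at most four vertices is a
spanning subgraph of a path `abcd`, so it suffices to find a Gallai vertex in connected graphs free of one of
`P₄`, `P₁ + P₃`, `2P₂`, `2P₁ + P₂`, `4P₁`. Let `x` be missed by a longest path `l`, let `C` be the
component of `x` in `G - l`, and let `T` be its set of attachments on `l`. The first vertex of `l`
and the successors of `T` form an independent set `S` of `|T| + 1` vertices without neighbours in
`C` (`IsLongestList.nonempty_detour`). In the first four cases, any vertex `x` of maximum degree is
a Gallai vertex: otherwise some attachment adjacent to all of `C` has at least `|T|` neighbours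
in `S ∪ T`, hence larger degree than `x` (`Detour.card_filter_adj_lt`). For `P₄` and `2P₂`, this is
an attachment with the most neighbours in `S` (`Detour.exists_card_le_of_nested`). In the case of
`4P₁`, the component `C` is a clique with a single attachment, and that attachment is a Gallai
vertex.
-/

namespace GallaiPaths

/-! ### Longest paths as vertex lists -/

section MissedVertices

variable {V : Type u} {G : SimpleGraph V}

/-- A path of `G`, recorded as the list of its vertices. The empty list is allowed. -/
def IsPathList (G : SimpleGraph V) (l : List V) : Prop :=
  l.IsChain G.Adj ∧ l.Nodup

/-- A path list with the maximum number of vertices. -/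
def IsLongestList (G : SimpleGraph V) (l : List V) : Prop :=
  IsPathList G l ∧ ∀ l' : List V, IsPathList G l' → l'.length ≤ l.length

theorem IsPathList.reverse {l : List V} (h : IsPathList G l) : IsPathList G l.reverse := by
  refine ⟨?_, by simpa using h.2⟩
  rw [List.isChain_reverse]
  exact h.1.imp fun _ _ h => h.symm

theorem IsLongestPath.isLongestList_support {a b : V} {p : G.Walk a b} (hp : IsLongestPath G p) :
    IsLongestList G p.support := by
  refine ⟨⟨p.isChain_adj_support, hp.1.support_nodup⟩, fun l' hl' => ?_⟩
  by_cases hne : l' = []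
  · simp [hne]
  · have h := hp.2 _ _ (SimpleGraph.Walk.ofSupport l' hne hl'.1)
      (by rw [SimpleGraph.Walk.isPath_def, SimpleGraph.Walk.support_ofSupport]; exact hl'.2)
    have h1 := (SimpleGraph.Walk.ofSupport l' hne hl'.1).length_support
    rw [SimpleGraph.Walk.support_ofSupport] at h1
    rw [p.length_support]
    omega

theorem isGallaiVertex_of_forall_isLongestList {x : V}
    (h : ∀ l, IsLongestList G l → x ∈ l) : IsGallaiVertex G x :=
  fun _ _ _ hp => ⟨x, rfl, h _ hp.isLongestList_support⟩

/-- The rerouting principle: a longest path `A ++ B ++ D` cannot be improved to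
`A ++ q ++ B.reverse ++ D` by inserting an outside path `q`. The lists `A` and `D` may be
empty, in which case the corresponding adjacency is vacuous. -/
theorem IsLongestList.not_reroute {A B D q : List V} (h : IsLongestList G (A ++ (B ++ D)))
    (hq : IsPathList G q) (hne : q ≠ []) (hdis : ∀ c ∈ q, c ∉ A ++ (B ++ D)) (hB : B ≠ [])
    (h1 : ∀ a ∈ A.getLast?, ∀ c ∈ q.head?, G.Adj a c)
    (h2 : ∀ c ∈ q.getLast?, ∀ b ∈ B.getLast?, G.Adj c b)
    (h3 : ∀ b ∈ B.head?, ∀ d ∈ D.head?, G.Adj b d) : False := by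
  obtain ⟨⟨hc, hn⟩, hmax⟩ := h
  have hlen := hmax (A ++ (q ++ (B.reverse ++ D))) ?_
  · have := List.length_pos_iff.2 hne
    simp only [List.length_append, List.length_reverse] at hlen
    omega
  rw [List.isChain_append, List.isChain_append] at hc
  constructor
  · rw [List.isChain_append, List.isChain_append, List.isChain_append]
    refine ⟨hc.1, ⟨hq.1, ⟨?_, hc.2.1.2.1, ?_⟩, ?_⟩, ?_⟩
    · rw [List.isChain_reverse]
      exact hc.2.1.1.imp fun _ _ h => h.symm
    · simpa using h3
    · intro c hcq b hb
      rw [List.head?_append_of_ne_nil _ (by simpa using hB), List.head?_reverse] at hb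
      exact h2 c hcq b hb
    · intro a ha c hcq
      rw [List.head?_append_of_ne_nil _ hne] at hcq
      exact h1 a ha c hcq
  · have hperm : (A ++ (q ++ (B.reverse ++ D))).Perm (q ++ (A ++ (B ++ D))) := by
      have e1 : (B.reverse ++ D).Perm (B ++ D) := (List.reverse_perm B).append_right D
      exact ((e1.append_left q).append_left A).trans
        (by rw [← List.append_assoc, ← List.append_assoc q]
            exact List.perm_append_comm.append_right _)
    rw [hperm.nodup_iff, List.nodup_append]
    refine ⟨hq.2, hn, fun a ha b hb hab => hdis a ha (hab ▸ hb)⟩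

/-- Position `j` of the list `l` directly follows a vertex with a neighbour in `C`, or is the
initial position. -/
def IsStart (G : SimpleGraph V) (C : Set V) (l : List V) (j : ℕ) : Prop :=
  j = 0 ∨ ∃ t, 1 ≤ j ∧ l[j - 1]? = some t ∧ ∃ c ∈ C, G.Adj c t

/-- Two start positions `j < j'` carry nonadjacent vertices; in particular `j'` is not past the
end of the path. Here any two vertices of `C` are joined by a path that avoids `l`. -/
theorem IsLongestList.not_adj_of_isStart {C : Set V} {l : List V} (h : IsLongestList G l)
    (hC : C.Nonempty)
    (hconn : ∀ c ∈ C, ∀ c' ∈ C, ∃ q, IsPathList G q ∧ q.head? = some c ∧ q.getLast? = some c' ∧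
      ∀ y ∈ q, y ∉ l)
    {j j' : ℕ} (hjj : j < j') (hj' : j' ≤ l.length) (hs : IsStart G C l j)
    (hs' : IsStart G C l j') {b : V} (hb : l[j]? = some b) :
    ∃ d, l[j']? = some d ∧ ¬ G.Adj b d := by
  by_contra! hcon
  obtain rfl | ⟨t', -, ht', c', hc', hct'⟩ := hs'
  · omega
  obtain ⟨c, hc, hct⟩ : ∃ c ∈ C, ∀ a ∈ (l.take j).getLast?, G.Adj c a := by
    obtain rfl | ⟨t, h1, ht, c, hc, hct⟩ := hs
    · exact ⟨_, hC.some_mem, by simp⟩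
    · refine ⟨c, hc, fun a ha => ?_⟩
      rw [List.getLast?_take, if_neg (by omega), ht] at ha
      simp at ha
      exact ha ▸ hct
  obtain ⟨q, hq, hqh, hql, hqd⟩ := hconn c hc c' hc'
  have hl : l = l.take j ++ ((l.take j').drop j ++ l.drop j') := by
    conv_lhs => rw [← List.take_append_drop j' l, ← List.take_append_drop j (l.take j')]
    rw [List.take_take, min_eq_left hjj.le, List.append_assoc]
  refine IsLongestList.not_reroute (G := G) (q := q) (A := l.take j) (B := (l.take j').drop j)
    (D := l.drop j') (hl ▸ h) hq (by rintro rfl; simp at hqh) (fun y hy => hl ▸ hqd y hy)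
    (fun hnil => ?_) (fun a ha y hy => ?_) (fun y hy a ha => ?_) (fun a ha d hd => ?_)
  · have := congrArg List.length hnil
    simp at this
    omega
  · rw [hqh] at hy
    simp at hy
    exact hy ▸ (hct a ha).symm
  · rw [hql] at hy
    simp at hy
    rw [List.getLast?_drop, if_neg (by simp; omega), List.getLast?_take, if_neg (by omega),
      ht'] at ha
    simp at ha
    exact ha ▸ hy ▸ hct'
  · rw [List.head?_drop] at ha hd
    rw [List.getElem?_take_of_lt hjj, hb] at ha
    simp at ha
    exact ha ▸ hcon d hd

/-! ### The structure around a missed vertex -/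

/-- The local structure around a vertex `x` missed by a longest path `l`. Here `C` is the component
of `x` in `G - l`, `T` is its set of attachments on `l`, `h` is the first vertex of `l`, and
`succ t` is the successor of `t` on `l`. The essential point is that `{h} ∪ succ '' T`
is an independent set of `|T| + 1` vertices without neighbours in `C`. -/
structure Detour (G : SimpleGraph V) (l : List V) (x : V) where
  /-- The component of `x` in `G - l`. -/
  C : Finset V
  /-- The attachments of `C` on `l`. -/
  T : Finset V
  /-- The first vertex of `l`. -/
  h : V
  /-- The successor on `l`; meaningful on `T` only. -/
  succ : V → V
  mem_C : x ∈ C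
  notMem_of_mem_C : ∀ c ∈ C, c ∉ l
  mem_of_mem_T : ∀ t ∈ T, t ∈ l
  h_mem : h ∈ l
  succ_mem : ∀ t ∈ T, succ t ∈ l
  T_nonempty : T.Nonempty
  exists_adj_C : ∀ t ∈ T, ∃ c ∈ C, G.Adj c t
  boundary : ∀ c ∈ C, ∀ u, G.Adj c u → u ∈ C ∨ u ∈ T
  C_connected : ∀ D : Set V, (∃ c ∈ C, c ∈ D) →
    (∀ c ∈ C, c ∈ D → ∀ c' ∈ C, G.Adj c c' → c' ∈ D) → ∀ c ∈ C, c ∈ D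
  succ_injOn : Set.InjOn succ T
  succ_ne_h : ∀ t ∈ T, succ t ≠ h
  adj_succ : ∀ t ∈ T, G.Adj t (succ t)
  not_adj_h_succ : ∀ t ∈ T, ¬ G.Adj h (succ t)
  not_adj_succ_succ : ∀ t ∈ T, ∀ t' ∈ T, ¬ G.Adj (succ t) (succ t')
  not_adj_C_h : ∀ c ∈ C, ¬ G.Adj c h
  not_adj_C_succ : ∀ c ∈ C, ∀ t ∈ T, ¬ G.Adj c (succ t)
  exists_pred : ∀ t ∈ T, ∃ p ∈ l, p ≠ succ t ∧ G.Adj t p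

theorem exists_isPathList_of_reachable {a b : V} (h : G.Reachable a b) :
    ∃ q, IsPathList G q ∧ q.head? = some a ∧ q.getLast? = some b := by
  obtain ⟨p, hp⟩ := h.exists_isPath
  refine ⟨p.support, ⟨p.isChain_adj_support, hp.support_nodup⟩, ?_, ?_⟩
  · rw [List.head?_eq_some_head p.support_ne_nil, p.head_support]
  · rw [List.getLast?_eq_some_getLast p.support_ne_nil, p.getLast_support]

theorem IsLongestList.ne_nil [Nonempty V] {l : List V} (hl : IsLongestList G l) : l ≠ [] := by
  rintro rfl
  obtain ⟨x⟩ := ‹Nonempty V›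
  simpa using hl.2 [x] ⟨by simp, by simp⟩

theorem IsLongestList.nonempty_detour [Finite V] (hG : G.Connected) {l : List V}
    (hl : IsLongestList G l) {x : V} (hx : x ∉ l) : Nonempty (Detour G l x) := by
  classical
  have : Fintype V := Fintype.ofFinite V
  have : Nonempty V := ⟨x⟩
  set U : Set V := {z | z ∉ l} with hU
  set K := G.induce U with hK
  set C : Finset V := Finset.univ.filter
    (fun y => ∃ hy : y ∈ U, K.Reachable ⟨x, hx⟩ ⟨y, hy⟩) with hCdef
  have memC : ∀ {y}, y ∈ C ↔ ∃ hy : y ∈ U, K.Reachable ⟨x, hx⟩ ⟨y, hy⟩ := by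
    intro y; simp [hCdef]
  have hxC : x ∈ C := memC.2 ⟨hx, SimpleGraph.Reachable.refl _⟩
  have hCl : ∀ c ∈ C, c ∉ l := fun c hc => (memC.1 hc).1
  have hCadj : ∀ c ∈ C, ∀ u, u ∉ l → G.Adj c u → u ∈ C := by
    intro c hc u hu hcu
    obtain ⟨hcU, hr⟩ := memC.1 hc
    refine memC.2 ⟨hu, hr.trans (SimpleGraph.Adj.reachable ?_)⟩
    simpa [hK] using hcu
  have hreach : ∀ c ∈ C, ∀ c' ∈ C, ∃ (hc : c ∈ U) (hc' : c' ∈ U),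
      K.Reachable ⟨c, hc⟩ ⟨c', hc'⟩ := by
    intro c hc c' hc'
    obtain ⟨h1, r1⟩ := memC.1 hc
    obtain ⟨h2, r2⟩ := memC.1 hc'
    exact ⟨h1, h2, r1.symm.trans r2⟩
  have hconn : ∀ c ∈ (C : Set V), ∀ c' ∈ (C : Set V), ∃ q, IsPathList G q ∧ q.head? = some c ∧
      q.getLast? = some c' ∧ ∀ y ∈ q, y ∉ l := by
    intro c hc c' hc'
    obtain ⟨h1, h2, hr⟩ := hreach c hc c' hc'
    obtain ⟨q, hq, hqh, hql⟩ := exists_isPathList_of_reachable hr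
    refine ⟨q.map Subtype.val, ⟨?_, hq.2.map Subtype.val_injective⟩,
      by rw [List.head?_map, hqh]; rfl,
      by rw [List.getLast?_map, hql]; rfl, ?_⟩
    · rw [List.isChain_map]
      exact hq.1.imp fun a b hab => by simpa [hK] using hab
    · intro y hy
      obtain ⟨z, -, rfl⟩ := List.mem_map.1 hy
      exact z.2
  have hCclosed : ∀ D : Set V, (∃ c ∈ C, c ∈ D) →
      (∀ c ∈ C, c ∈ D → ∀ c' ∈ C, G.Adj c c' → c' ∈ D) → ∀ c ∈ C, c ∈ D := by
    rintro D ⟨c, hc, hcD⟩ hD c' hc'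
    obtain ⟨h1, h2, ⟨w⟩⟩ := hreach c hc c' hc'
    have key : ∀ (a b : U), K.Walk a b → a.1 ∈ C → a.1 ∈ D → b.1 ∈ D := by
      intro a b w
      induction w with
      | nil => exact fun _ h => h
      | @cons a b _ hab _ ih =>
        intro haC haD
        have hab' : G.Adj a.1 b.1 := by simpa [hK] using hab
        have hbC := hCadj _ haC _ b.2 hab'
        exact ih hbC (hD _ haC haD _ hbC hab')
    exact key _ _ w hc hcD
  set T : Finset V := Finset.univ.filter (fun t => t ∈ l ∧ ∃ c ∈ C, G.Adj c t) with hTdef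
  have memT : ∀ {t}, t ∈ T ↔ t ∈ l ∧ ∃ c ∈ C, G.Adj c t := by intro y; simp [hTdef]
  have hbd : ∀ c ∈ C, ∀ u, G.Adj c u → u ∈ C ∨ u ∈ T := by
    intro c hc u hcu
    by_cases hu : u ∈ l
    · exact Or.inr (memT.2 ⟨hu, c, hc, hcu⟩)
    · exact Or.inl (hCadj c hc u hu hcu)
  have hlpos : 0 < l.length := List.length_pos_iff.2 hl.ne_nil
  have hTne : T.Nonempty := by
    by_contra hT
    rw [Finset.not_nonempty_iff_eq_empty] at hT
    have key : ∀ a b : V, G.Walk a b → a ∈ C → b ∈ C := by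
      intro a b w
      induction w with
      | nil => exact id
      | @cons a b _ hab _ ih =>
        intro ha
        refine ih ((hbd a ha b hab).resolve_right ?_)
        simp [hT]
    obtain ⟨w⟩ := hG.preconnected x l[0]
    exact hCl _ (key _ _ w hxC) (List.getElem_mem _)
  have hCne : (C : Set V).Nonempty := ⟨x, hxC⟩
  have hget : ∀ t ∈ T, l[l.idxOf t]? = some t := fun t ht => List.getElem?_idxOf (memT.1 ht).1
  have hidx : ∀ t ∈ T, l.idxOf t < l.length := fun t ht => List.idxOf_lt_length_iff.2 (memT.1 ht).1
  have hst : ∀ t ∈ T, IsStart G (C : Set V) l (l.idxOf t + 1) := fun t ht =>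
    Or.inr ⟨t, by omega, by simpa using hget t ht, (memT.1 ht).2⟩
  have h0 : l[0]? = some l[0] := List.getElem?_eq_getElem hlpos
  have hadj : ∀ i b d, l[i]? = some b → l[i + 1]? = some d → G.Adj b d := by
    intro i b d hb hd
    obtain ⟨h1, rfl⟩ := List.getElem?_eq_some_iff.1 hb
    obtain ⟨h2, rfl⟩ := List.getElem?_eq_some_iff.1 hd
    exact hl.1.1.getElem _ _
  -- Two consecutive start positions would carry adjacent vertices.
  have hnostart : ∀ i, IsStart G (C : Set V) l i → ∀ b, l[i]? = some b →
      ∀ c ∈ C, ¬ G.Adj c b := by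
    intro i hi b hb c hc hcb
    obtain ⟨hilt, -⟩ := List.getElem?_eq_some_iff.1 hb
    obtain ⟨d, hd, hbd⟩ := hl.not_adj_of_isStart hCne hconn (Nat.lt_succ_self i) hilt hi
      (Or.inr ⟨b, by omega, by simpa using hb, c, hc, hcb⟩) hb
    exact hbd (hadj i b d hb hd)
  choose! sc hsc hhsc using fun t (ht : t ∈ T) =>
    hl.not_adj_of_isStart hCne hconn (Nat.succ_pos _) (hidx t ht) (Or.inl rfl) (hst t ht) h0
  have hinj : ∀ {i j : ℕ} {b : V}, l[i]? = some b → l[j]? = some b → i = j := by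
    intro i j b hi hj
    obtain ⟨h1, h1'⟩ := List.getElem?_eq_some_iff.1 hi
    obtain ⟨h2, h2'⟩ := List.getElem?_eq_some_iff.1 hj
    exact (hl.1.2.getElem_inj_iff).1 (h1'.trans h2'.symm)
  have hidxinj : ∀ t ∈ T, ∀ t' ∈ T, l.idxOf t = l.idxOf t' → t = t' := by
    intro t ht t' ht' he
    have := hget t ht
    rw [he, hget t' ht'] at this
    exact (Option.some.inj this).symm
  have hss : ∀ t ∈ T, ∀ t' ∈ T, l.idxOf t < l.idxOf t' → ¬ G.Adj (sc t) (sc t') := by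
    intro t ht t' ht' hlt
    obtain ⟨d, hd, hbd⟩ := hl.not_adj_of_isStart hCne hconn (Nat.succ_lt_succ hlt) (hidx t' ht')
      (hst t ht) (hst t' ht') (hsc t ht)
    rw [hsc t' ht'] at hd
    exact (Option.some.inj hd) ▸ hbd
  refine ⟨⟨C, T, l[0], sc, hxC, hCl, fun t ht => (memT.1 ht).1, List.getElem_mem _,
    fun t ht => List.mem_of_getElem? (hsc t ht), hTne, fun t ht => (memT.1 ht).2, hbd, hCclosed,
    ?_, ?_, ?_, hhsc, ?_, ?_, ?_, ?_⟩⟩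
  · intro t ht t' ht' he
    have := hsc t ht
    rw [he] at this
    exact hidxinj t ht t' ht' (by simpa using hinj this (hsc t' ht'))
  · intro t ht he
    have := hsc t ht
    rw [he] at this
    simpa using hinj this h0
  · exact fun t ht => hadj _ _ _ (hget t ht) (hsc t ht)
  · intro t ht t' ht' hadj'
    rcases lt_trichotomy (l.idxOf t) (l.idxOf t') with h | h | h
    · exact hss t ht t' ht' h hadj'
    · exact G.loopless.irrefl _ (hidxinj t ht t' ht' h ▸ hadj')
    · exact hss t' ht' t ht h hadj'.symm
  · exact fun c hc => hnostart 0 (Or.inl rfl) _ h0 c hc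
  · exact fun c hc t ht => hnostart _ (hst t ht) _ (hsc t ht) c hc
  · intro t ht
    obtain ⟨c, hc, hct⟩ := (memT.1 ht).2
    have hpos : 0 < l.idxOf t := by
      by_contra hz
      have h := hget t ht
      rw [show l.idxOf t = 0 by omega, h0] at h
      exact hnostart 0 (Or.inl rfl) _ h0 c hc ((Option.some.inj h) ▸ hct)
    have hlt := hidx t ht
    have hp : l[l.idxOf t - 1]? = some (l[l.idxOf t - 1]'(by omega)) :=
      List.getElem?_eq_getElem _
    refine ⟨l[l.idxOf t - 1]'(by omega), List.getElem_mem _, fun he => ?_, ?_⟩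
    · rw [he] at hp
      have := hinj hp (hsc t ht)
      omega
    · exact (hadj _ _ _ hp (by rw [Nat.sub_add_cancel hpos]; exact hget t ht)).symm

/-! ### Gallai vertices in graphs without a small linear forest -/

namespace Detour

variable {l : List V} {x : V}

theorem disjoint_C_T (D : Detour G l x) : Disjoint D.C D.T := by
  rw [Finset.disjoint_left]
  exact fun s hs ht => D.notMem_of_mem_C s hs (D.mem_of_mem_T s ht)

/-- If `C` has no edge, then it consists of `x` alone. -/
theorem eq_of_mem_C (D : Detour G l x) (h : ∀ c ∈ D.C, ∀ c' ∈ D.C, ¬ G.Adj c c') {c : V}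
    (hc : c ∈ D.C) : c = x :=
  D.C_connected {x} ⟨x, D.mem_C, rfl⟩ (fun a ha _ b hb hab => (h a ha b hb hab).elim) c hc

variable [DecidableEq V]

/-- The first vertex of the path together with the successors of the attachments. -/
def S (D : Detour G l x) : Finset V := insert D.h (D.T.image D.succ)

variable (D : Detour G l x)

theorem mem_S {s : V} : s ∈ D.S ↔ s = D.h ∨ ∃ t ∈ D.T, D.succ t = s := by
  simp [S]

theorem h_mem_S : D.h ∈ D.S := D.mem_S.2 (Or.inl rfl)

theorem succ_mem_S {t : V} (ht : t ∈ D.T) : D.succ t ∈ D.S := D.mem_S.2 (Or.inr ⟨t, ht, rfl⟩)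

theorem card_S : D.S.card = D.T.card + 1 := by
  rw [S, Finset.card_insert_of_notMem, Finset.card_image_of_injOn D.succ_injOn]
  intro h
  obtain ⟨t, ht, he⟩ := Finset.mem_image.1 h
  exact D.succ_ne_h t ht he

theorem not_adj_S {s s' : V} (hs : s ∈ D.S) (hs' : s' ∈ D.S) : ¬ G.Adj s s' := by
  obtain rfl | ⟨t, ht, rfl⟩ := D.mem_S.1 hs <;> obtain rfl | ⟨t', ht', rfl⟩ := D.mem_S.1 hs'
  · exact G.loopless.irrefl _
  · exact D.not_adj_h_succ t' ht'
  · exact fun h => D.not_adj_h_succ t ht h.symm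
  · exact D.not_adj_succ_succ t ht t' ht'

theorem not_adj_C_S {c s : V} (hc : c ∈ D.C) (hs : s ∈ D.S) : ¬ G.Adj c s := by
  obtain rfl | ⟨t, ht, rfl⟩ := D.mem_S.1 hs
  · exact D.not_adj_C_h c hc
  · exact D.not_adj_C_succ c hc t ht

theorem mem_of_mem_S {s : V} (hs : s ∈ D.S) : s ∈ l := by
  obtain rfl | ⟨t, ht, rfl⟩ := D.mem_S.1 hs
  · exact D.h_mem
  · exact D.succ_mem t ht

theorem disjoint_S_T : Disjoint D.S D.T := by
  rw [Finset.disjoint_left]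
  intro s hs ht
  obtain ⟨c, hc, hcs⟩ := D.exists_adj_C s ht
  exact D.not_adj_C_S hc hs hcs

theorem disjoint_C_S : Disjoint D.C D.S := by
  rw [Finset.disjoint_left]
  exact fun s hs ht => D.notMem_of_mem_C s hs (D.mem_of_mem_S ht)

/-- The missed vertex has at most `|C| - 1 + |T|` neighbours, so an attachment adjacent to all of
`C` has larger degree as soon as it has `|T|` neighbours in the disjoint sets `S` and `T`. -/
theorem card_filter_adj_lt [Fintype V] [DecidableRel G.Adj] {t : V}
    (hdeg : G.degree t ≤ G.degree x) (hC : ∀ c ∈ D.C, G.Adj t c) :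
    (D.S.filter (G.Adj t)).card + (D.T.filter (G.Adj t)).card < D.T.card := by
  have h1 : G.degree x + 1 ≤ D.C.card + D.T.card := by
    have hsub : insert x (G.neighborFinset x) ⊆ D.C ∪ D.T := by
      intro y hy
      rw [Finset.mem_insert, SimpleGraph.mem_neighborFinset] at hy
      rw [Finset.mem_union]
      obtain rfl | hy := hy
      · exact Or.inl D.mem_C
      · exact D.boundary x D.mem_C y hy
    have := (Finset.card_le_card hsub).trans (Finset.card_union_le _ _)
    rwa [Finset.card_insert_of_notMem (by simp), SimpleGraph.card_neighborFinset_eq_degree] at this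
  have h2 : D.C.card + ((D.S.filter (G.Adj t)).card + (D.T.filter (G.Adj t)).card)
      ≤ G.degree t := by
    rw [← Finset.card_union_of_disjoint
        (D.disjoint_S_T.mono (Finset.filter_subset _ _) (Finset.filter_subset _ _)),
      ← Finset.card_union_of_disjoint (Finset.disjoint_union_right.2
        ⟨D.disjoint_C_S.mono_right (Finset.filter_subset _ _),
          D.disjoint_C_T.mono_right (Finset.filter_subset _ _)⟩),
      ← SimpleGraph.card_neighborFinset_eq_degree]
    refine Finset.card_le_card fun y hy => ?_
    rw [SimpleGraph.mem_neighborFinset]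
    simp only [Finset.mem_union, Finset.mem_filter] at hy
    rcases hy with hy | hy | hy
    exacts [hC y hy, hy.2, hy.2]
  omega

/-- The exchange argument: suppose that nonadjacent attachments have nested neighbourhoods in `S`.
An attachment `t` with the most neighbours in `S` is then adjacent to the predecessor of each
`s ∈ S \ {h}` that it is not adjacent to, since that predecessor sees `s`. -/
theorem exists_card_le_of_nested [DecidableRel G.Adj]
    (hnest : ∀ t ∈ D.T, ∀ t' ∈ D.T, ∀ s ∈ D.S, ∀ s' ∈ D.S, G.Adj t s → G.Adj t' s' →
      ¬ G.Adj t s' → ¬ G.Adj t t' → G.Adj t' s) :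
    ∃ t ∈ D.T, D.T.card ≤ (D.S.filter (G.Adj t)).card + (D.T.filter (G.Adj t)).card := by
  obtain ⟨t, ht, hmax⟩ := D.T.exists_max_image (fun t => (D.S.filter (G.Adj t)).card) D.T_nonempty
  refine ⟨t, ht, ?_⟩
  have hsub : D.S.filter (fun s => ¬ G.Adj t s) ⊆
      insert D.h ((D.T.filter (G.Adj t)).image D.succ) := by
    intro s hs
    rw [Finset.mem_filter] at hs
    rw [Finset.mem_insert, Finset.mem_image]
    refine (D.mem_S.1 hs.1).imp_right ?_
    rintro ⟨t', ht', rfl⟩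
    refine ⟨t', Finset.mem_filter.2 ⟨ht', ?_⟩, rfl⟩
    by_contra htt'
    refine (hmax t' ht').not_gt (Finset.card_lt_card ?_)
    rw [Finset.ssubset_iff_of_subset]
    · exact ⟨D.succ t', Finset.mem_filter.2 ⟨hs.1, D.adj_succ t' ht'⟩,
        fun h => hs.2 (Finset.mem_filter.1 h).2⟩
    · intro s hs'
      rw [Finset.mem_filter] at hs' ⊢
      exact ⟨hs'.1, hnest t ht t' ht' s hs'.1 _ hs.1 hs'.2 (D.adj_succ t' ht') hs.2 htt'⟩
  have h1 := (Finset.card_le_card hsub).trans (Finset.card_insert_le _ _)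
  have h2 : ((D.T.filter (G.Adj t)).image D.succ).card ≤ (D.T.filter (G.Adj t)).card :=
    Finset.card_image_le
  have h3 : (D.S.filter (G.Adj t)).card + (D.S.filter (fun s => ¬ G.Adj t s)).card = D.S.card :=
    Finset.card_filter_add_card_filter_not _
  have h4 := D.card_S
  omega

end Detour

/-- In a `2P₂`-free graph, the vertices missed by a longest path with at least two vertices are
independent: an outside edge `ab` would see the first edge `yz` of the path, and replacing `y` by
`a` and `b` would lengthen the path. -/
theorem IsLongestList.not_adj_of_free_twoEdges
    (hfree : ∀ a b c d, G.Adj a b → G.Adj c d → ¬ G.Adj a c → ¬ G.Adj a d → ¬ G.Adj b c →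
      ¬ G.Adj b d → False)
    {l : List V} (hl : IsLongestList G l) {t s a b : V} (ht : t ∈ l) (hs : s ∈ l) (hts : t ≠ s)
    (hal : a ∉ l) (hbl : b ∉ l) : ¬ G.Adj a b := by
  intro hab
  obtain _ | ⟨y, _ | ⟨z, r⟩⟩ := l
  · simp at ht
  · simp only [List.mem_singleton] at ht hs
    exact hts (ht.trans hs.symm)
  · obtain ⟨⟨hch, hnd⟩, hmax⟩ := hl
    rw [List.isChain_cons_cons] at hch
    have hy : ∀ c, c ∉ y :: z :: r → ¬ G.Adj y c := by
      intro c hc hyc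
      have := hmax (c :: y :: z :: r) ⟨by
        rw [List.isChain_cons_cons, List.isChain_cons_cons]; exact ⟨hyc.symm, hch⟩,
        List.nodup_cons.2 ⟨hc, hnd⟩⟩
      simp at this
    have hz : ∀ c d, c ∉ y :: z :: r → d ∉ y :: z :: r → G.Adj c d → ¬ G.Adj z c := by
      intro c d hc hd hcd hzc
      have := hmax (d :: c :: z :: r) ⟨by
        rw [List.isChain_cons_cons, List.isChain_cons_cons]; exact ⟨hcd.symm, hzc.symm, hch.2⟩,
        List.nodup_cons.2 ⟨?_, List.nodup_cons.2 ⟨fun h => hc (by simp [h]), hnd.of_cons⟩⟩⟩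
      · simp at this
      · intro h
        obtain rfl | h := List.mem_cons.1 h
        · exact G.loopless.irrefl _ hcd
        · exact hd (List.mem_cons_of_mem _ h)
    exact hfree y z a b hch.1 hab (hy a hal) (hy b hbl) (hz a b hal hbl hab)
      (hz b a hbl hal hab.symm)

section MaxDegree

variable [Fintype V] [DecidableRel G.Adj] {x : V} {l : List V}

/-- In a connected `2P₂`-free graph, vertices of maximum degree lie on all longest paths. -/
theorem mem_of_free_twoEdges (hG : G.Connected)
    (hfree : ∀ a b c d, G.Adj a b → G.Adj c d → ¬ G.Adj a c → ¬ G.Adj a d → ¬ G.Adj b c →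
      ¬ G.Adj b d → False)
    (hx : ∀ y, G.degree y ≤ G.degree x) (hl : IsLongestList G l) : x ∈ l := by
  classical
  by_contra hxl
  obtain ⟨D⟩ := hl.nonempty_detour hG hxl
  have hC : ∀ a ∈ D.C, ∀ b ∈ D.C, ¬ G.Adj a b := by
    intro a ha b hb
    obtain ⟨t, ht⟩ := D.T_nonempty
    exact hl.not_adj_of_free_twoEdges hfree (D.mem_of_mem_T t ht) (D.succ_mem t ht)
      (D.adj_succ t ht).ne (D.notMem_of_mem_C a ha) (D.notMem_of_mem_C b hb)
  have hCx : ∀ t ∈ D.T, G.Adj t x := by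
    intro t ht
    obtain ⟨c, hc, hct⟩ := D.exists_adj_C t ht
    exact D.eq_of_mem_C hC hc ▸ hct.symm
  obtain ⟨t, ht, hle⟩ := D.exists_card_le_of_nested
    (fun t ht t' ht' s hs s' hs' hts hts' hnts' htt' => by
      by_contra hcon
      exact hfree t s t' s' hts hts' htt' hnts' (fun h => hcon h.symm) (D.not_adj_S hs hs'))
  exact hle.not_gt (D.card_filter_adj_lt (hx t) fun c hc => D.eq_of_mem_C hC hc ▸ hCx t ht)

/-- In a connected `P₄`-free graph, vertices of maximum degree lie on all longest paths. -/
theorem mem_of_free_pathFour (hG : G.Connected)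
    (hfree : ∀ a b c d, G.Adj a b → G.Adj b c → G.Adj c d → ¬ G.Adj a c → ¬ G.Adj b d →
      ¬ G.Adj a d → False)
    (hx : ∀ y, G.degree y ≤ G.degree x) (hl : IsLongestList G l) : x ∈ l := by
  classical
  by_contra hxl
  obtain ⟨D⟩ := hl.nonempty_detour hG hxl
  -- An attachment that sees only part of the connected set `C` starts an induced path on its
  -- successor, itself and an edge of `C`.
  have hC : ∀ t ∈ D.T, ∀ c ∈ D.C, G.Adj t c := by
    intro t ht
    obtain ⟨c, hc, hct⟩ := D.exists_adj_C t ht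
    refine D.C_connected {c | G.Adj t c} ⟨c, hc, hct.symm⟩ fun a ha hta b hb hab => ?_
    by_contra htb
    exact hfree (D.succ t) t a b (D.adj_succ t ht).symm hta hab
      (fun h => D.not_adj_C_succ a ha t ht h.symm) htb
      (fun h => D.not_adj_C_succ b hb t ht h.symm)
  obtain ⟨t, ht, hle⟩ := D.exists_card_le_of_nested
    (fun t ht t' ht' s hs s' hs' hts hts' hnts' htt' => by
      by_contra hcon
      exact hfree s t x t' hts.symm (hC t ht x D.mem_C) (hC t' ht' x D.mem_C).symm
        (fun h => D.not_adj_C_S D.mem_C hs h.symm) htt' (fun h => hcon h.symm))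
  exact hle.not_gt (D.card_filter_adj_lt (hx t) (hC t ht))

/-- In a connected `(P₁ + P₃)`-free graph, vertices of maximum degree lie on all longest paths. -/
theorem mem_of_free_pathThree_add_vertex (hG : G.Connected)
    (hfree : ∀ a b c d, G.Adj a b → G.Adj b c → ¬ G.Adj a c → a ≠ c → ¬ G.Adj d a → ¬ G.Adj d b →
      ¬ G.Adj d c → False)
    (hx : ∀ y, G.degree y ≤ G.degree x) (hl : IsLongestList G l) : x ∈ l := by
  classical
  by_contra hxl
  obtain ⟨D⟩ := hl.nonempty_detour hG hxl
  obtain ⟨t, ht⟩ := D.T_nonempty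
  obtain ⟨c₀, hc₀, hc₀t⟩ := D.exists_adj_C t ht
  have hne : ∀ {c s}, c ∈ D.C → s ∈ D.S → c ≠ s := fun hc hs h =>
    Finset.disjoint_left.1 D.disjoint_C_S hc (h ▸ hs)
  have hsucc := D.succ_mem_S ht
  -- A vertex with two neighbours in an independent set sees the whole set.
  have hS : ∀ s ∈ D.S, G.Adj t s := by
    intro s hs
    by_contra hts
    exact hfree c₀ t (D.succ t) s hc₀t (D.adj_succ t ht) (D.not_adj_C_S hc₀ hsucc)
      (hne hc₀ hsucc) (fun h => D.not_adj_C_S hc₀ hs h.symm) (fun h => hts h.symm)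
      (D.not_adj_S hs hsucc)
  have hC : ∀ c ∈ D.C, G.Adj t c := by
    intro c hc
    by_contra htc
    exact hfree D.h t (D.succ t) c (hS _ D.h_mem_S).symm (D.adj_succ t ht)
      (D.not_adj_h_succ t ht) (D.succ_ne_h t ht).symm (D.not_adj_C_h c hc) (fun h => htc h.symm)
      (D.not_adj_C_succ c hc t ht)
  have h1 := D.card_filter_adj_lt (hx t) hC
  rw [Finset.filter_true_of_mem hS, D.card_S] at h1
  omega

/-- In a connected `(2P₁ + P₂)`-free graph, vertices of maximum degree lie on all longest paths. -/
theorem mem_of_free_edge_add_two_vertices (hG : G.Connected)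
    (hfree : ∀ a b c d, G.Adj a b → ¬ G.Adj c d → c ≠ d → ¬ G.Adj c a → ¬ G.Adj c b → ¬ G.Adj d a →
      ¬ G.Adj d b → False)
    (hx : ∀ y, G.degree y ≤ G.degree x) (hl : IsLongestList G l) : x ∈ l := by
  classical
  by_contra hxl
  obtain ⟨D⟩ := hl.nonempty_detour hG hxl
  obtain ⟨t, ht⟩ := D.T_nonempty
  obtain ⟨c₀, hc₀, hc₀t⟩ := D.exists_adj_C t ht
  have hCx : ∀ c ∈ D.C, c = x := fun c hc => D.eq_of_mem_C (fun a ha b hb hab =>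
    hfree a b D.h (D.succ t) hab (D.not_adj_h_succ t ht) (D.succ_ne_h t ht).symm
      (fun h => D.not_adj_C_h a ha h.symm) (fun h => D.not_adj_C_h b hb h.symm)
      (fun h => D.not_adj_C_succ a ha t ht h.symm) (fun h => D.not_adj_C_succ b hb t ht h.symm)) hc
  have hxt : G.Adj t x := hCx c₀ hc₀ ▸ hc₀t.symm
  -- The edge `tx` sees all but at most one vertex of the independent set `S`.
  have hle : (D.S.filter (fun s => ¬ G.Adj t s)).card ≤ 1 := by
    rw [Finset.card_le_one]
    intro a ha b hb
    rw [Finset.mem_filter] at ha hb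
    by_contra hab
    exact hfree t x a b hxt (D.not_adj_S ha.1 hb.1) hab (fun h => ha.2 h.symm)
      (fun h => D.not_adj_C_S D.mem_C ha.1 h.symm) (fun h => hb.2 h.symm)
      (fun h => D.not_adj_C_S D.mem_C hb.1 h.symm)
  have h1 := D.card_filter_adj_lt (hx t) (fun c hc => hCx c hc ▸ hxt)
  have h2 : (D.S.filter (G.Adj t)).card + (D.S.filter (fun s => ¬ G.Adj t s)).card = D.S.card :=
    Finset.card_filter_add_card_filter_not _
  have h3 := D.card_S
  omega

end MaxDegree

/-- In a connected graph with independence number at most three, the component missed by a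
longest path has a single attachment, and that attachment lies on all longest paths. -/
theorem exists_mem_of_free_four_vertices [Finite V] (hG : G.Connected)
    (hfree : ∀ a b c d, a ≠ b → a ≠ c → a ≠ d → b ≠ c → b ≠ d → c ≠ d → ¬ G.Adj a b → ¬ G.Adj a c →
      ¬ G.Adj a d → ¬ G.Adj b c → ¬ G.Adj b d → ¬ G.Adj c d → False) :
    ∃ v, ∀ l, IsLongestList G l → v ∈ l := by
  classical
  have hT : ∀ {l x} (D : Detour G l x), ∀ t ∈ D.T, ∀ t' ∈ D.T, t = t' := by
    intro l x D t ht t' ht'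
    by_contra hne
    have hnm : ∀ {s}, s ∈ D.S → x ≠ s := fun hs h =>
      Finset.disjoint_left.1 D.disjoint_C_S D.mem_C (h ▸ hs)
    exact hfree x D.h (D.succ t) (D.succ t') (hnm D.h_mem_S) (hnm (D.succ_mem_S ht))
      (hnm (D.succ_mem_S ht')) (D.succ_ne_h t ht).symm (D.succ_ne_h t' ht').symm
      (fun h => hne (D.succ_injOn ht ht' h)) (D.not_adj_C_h x D.mem_C)
      (D.not_adj_C_succ x D.mem_C t ht) (D.not_adj_C_succ x D.mem_C t' ht')
      (D.not_adj_h_succ t ht) (D.not_adj_h_succ t' ht') (D.not_adj_succ_succ t ht t' ht')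
  have hC : ∀ {l x} (D : Detour G l x), ∀ c ∈ D.C, ∀ c' ∈ D.C, c ≠ c' → G.Adj c c' := by
    intro l x D c hc c' hc' hne
    by_contra hcc'
    obtain ⟨t, ht⟩ := D.T_nonempty
    have hnm : ∀ {c s}, c ∈ D.C → s ∈ D.S → c ≠ s := fun hc hs h =>
      Finset.disjoint_left.1 D.disjoint_C_S hc (h ▸ hs)
    exact hfree c c' D.h (D.succ t) hne (hnm hc D.h_mem_S) (hnm hc (D.succ_mem_S ht))
      (hnm hc' D.h_mem_S) (hnm hc' (D.succ_mem_S ht)) (D.succ_ne_h t ht).symm hcc'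
      (D.not_adj_C_h c hc) (D.not_adj_C_succ c hc t ht) (D.not_adj_C_h c' hc')
      (D.not_adj_C_succ c' hc' t ht) (D.not_adj_h_succ t ht)
  by_contra! hcon
  obtain ⟨x₀⟩ := hG.nonempty
  obtain ⟨l, hl, hx₀l⟩ := hcon x₀
  obtain ⟨D⟩ := hl.nonempty_detour hG hx₀l
  obtain ⟨v, hv⟩ := D.T_nonempty
  obtain ⟨m, hm, hvm⟩ := hcon v
  obtain ⟨E⟩ := hm.nonempty_detour hG hvm
  obtain ⟨w, hw⟩ := E.T_nonempty
  have hbd : ∀ c ∈ D.C, ∀ u, G.Adj c u → u ∈ D.C ∨ u = v := fun c hc u hcu =>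
    (D.boundary c hc u hcu).imp_right fun hu => hT D u hu v hv
  -- The path `m` avoids the cut vertex `v`, and the clique `D.C` cannot contain `m` because
  -- `m` carries two nonadjacent vertices.
  have hmC : ∀ c ∈ D.C, c ∉ m := by
    intro c hc hcm
    have hsub : ∀ y ∈ m, y ∈ D.C := by
      obtain ⟨A, B, rfl⟩ := List.append_of_mem hcm
      have hprop : ∀ (B : List V) (c : V), c ∈ D.C → List.IsChain G.Adj (c :: B) → v ∉ B →
          ∀ y ∈ B, y ∈ D.C := by
        intro B
        induction B with
        | nil => simp
        | cons b B ih =>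
          intro c hc hch hvB y hy
          rw [List.isChain_cons_cons] at hch
          have hb : b ∈ D.C := (hbd c hc b hch.1).resolve_right (fun h => hvB (by simp [h]))
          obtain rfl | hy := List.mem_cons.1 hy
          · exact hb
          · exact ih b hb hch.2 (fun h => hvB (by simp [h])) y hy
      have h1 := hm.1.1
      have h2 := hm.1.reverse.1
      simp only [List.reverse_append, List.reverse_cons, List.append_assoc, List.cons_append,
        List.nil_append] at h2
      rw [List.isChain_append] at h1 h2
      intro y hy
      obtain hy | hy := List.mem_append.1 hy
      · exact hprop _ c hc h2.2.1 (fun h => hvm (by simp at h; simp [h])) y (by simpa using hy)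
      · obtain rfl | hy := List.mem_cons.1 hy
        · exact hc
        · exact hprop _ c hc h1.2.1 (fun h => hvm (by simp [h])) y hy
    exact E.not_adj_h_succ w hw (hC D _ (hsub _ E.h_mem) _ (hsub _ (E.succ_mem w hw))
      (E.succ_ne_h w hw).symm)
  obtain ⟨c, hc, hcv⟩ := D.exists_adj_C v hv
  have hcE : c ∈ E.C := (E.boundary v E.mem_C c hcv.symm).resolve_right
    fun h => hmC c hc (E.mem_of_mem_T c h)
  -- A neighbour of `v` outside `D.C` is not in the clique `E.C`, as `c` does not see it.
  have hnb : ∀ p, p ∈ l → G.Adj v p → p = w := by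
    intro p hp hvp
    refine (E.boundary v E.mem_C p hvp).elim (fun hpE => ?_) (fun h => hT E p h w hw)
    have hcp : c ≠ p := fun h => D.notMem_of_mem_C c hc (h ▸ hp)
    obtain h | h := hbd c hc p (hC E c hcE p hpE hcp)
    · exact (D.notMem_of_mem_C p h hp).elim
    · exact (hvp.ne h.symm).elim
  obtain ⟨p, hp, hpne, hvp⟩ := D.exists_pred v hv
  exact hpne ((hnb p hp hvp).trans (hnb _ (D.succ_mem v hv) (D.adj_succ v hv)).symm)

end MissedVertices

/-! ### Linear forests on at most four vertices -/

/-- `H` contains a triangle, a 4-cycle or a claw as a (not necessarily induced) subgraph. On at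
most four vertices these are the obstructions to being a linear forest. -/
inductive HasObstruction {V : Type u} (H : SimpleGraph V) : Prop
  | triangle {a b c : V} (hab : H.Adj a b) (hbc : H.Adj b c) (hca : H.Adj c a)
  | fourCycle {a b c d : V} (hab : H.Adj a b) (hbc : H.Adj b c) (hcd : H.Adj c d)
      (hda : H.Adj d a) (hac : a ≠ c) (hbd : b ≠ d)
  | claw {a b c d : V} (hab : H.Adj a b) (hac : H.Adj a c) (had : H.Adj a d)
      (hbc : b ≠ c) (hbd : b ≠ d) (hcd : c ≠ d)

theorem HasObstruction.map_hom {V : Type u} {W : Type v} {H : SimpleGraph V} {G : SimpleGraph W}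
    (f : H →g G) (hf : Function.Injective f) (h : HasObstruction H) : HasObstruction G := by
  cases h with
  | triangle h1 h2 h3 => exact .triangle (f.map_adj h1) (f.map_adj h2) (f.map_adj h3)
  | fourCycle h1 h2 h3 h4 h5 h6 =>
    exact .fourCycle (f.map_adj h1) (f.map_adj h2) (f.map_adj h3) (f.map_adj h4) (hf.ne h5)
      (hf.ne h6)
  | claw h1 h2 h3 h4 h5 h6 =>
    exact .claw (f.map_adj h1) (f.map_adj h2) (f.map_adj h3) (hf.ne h4) (hf.ne h5) (hf.ne h6)

/-- Adding isolated vertices creates no obstruction. -/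
theorem HasObstruction.of_map {V : Type u} {W : Type v} {H : SimpleGraph V} (f : V ↪ W)
    (h : HasObstruction (H.map f)) : HasObstruction H := by
  have key : ∀ {x y}, (H.map f).Adj x y → ∃ a b, f a = x ∧ f b = y ∧ H.Adj a b := by
    intro x y hxy
    obtain ⟨a, b, hab, rfl, rfl⟩ := (SimpleGraph.map_adj f H _ _).1 hxy
    exact ⟨a, b, rfl, rfl, hab⟩
  have hadj : ∀ {a b}, (H.map f).Adj (f a) (f b) → H.Adj a b := fun h => by
    simpa using h
  cases h with
  | triangle h1 h2 h3 =>
    obtain ⟨a, b, rfl, rfl, hab⟩ := key h1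
    obtain ⟨c, -, rfl, -, -⟩ := key h3
    exact .triangle hab (hadj h2) (hadj h3)
  | fourCycle h1 h2 h3 h4 h5 h6 =>
    obtain ⟨a, b, rfl, rfl, hab⟩ := key h1
    obtain ⟨c, d, rfl, rfl, hcd⟩ := key h3
    exact .fourCycle hab (hadj h2) hcd (hadj h4) (fun h => h5 (h ▸ rfl)) (fun h => h6 (h ▸ rfl))
  | claw h1 h2 h3 h4 h5 h6 =>
    obtain ⟨a, b, rfl, rfl, hab⟩ := key h1
    obtain ⟨c, -, rfl, -, -⟩ := key h2.symm
    obtain ⟨d, -, rfl, -, -⟩ := key h3.symm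
    exact .claw hab (hadj h2) (hadj h3) (fun h => h4 (h ▸ rfl)) (fun h => h5 (h ▸ rfl))
      (fun h => h6 (h ▸ rfl))

theorem IsLinearForest.not_hasObstruction {V : Type u} {H : SimpleGraph V}
    (h : IsLinearForest H) : ¬ HasObstruction H := by
  intro hobs
  cases hobs with
  | @triangle a b c h1 h2 h3 =>
    have := (h.1.subsingleton_path _ _).elim ⟨.cons h1 .nil, by simp [h1.ne]⟩
      ⟨.cons h3.symm (.cons h2.symm .nil), by simp [h1.ne, h2.ne.symm, h3.ne.symm]⟩
    simpa using congrArg (fun p : H.Path a b => p.1.length) this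
  | @fourCycle a b c d h1 h2 h3 h4 h5 h6 =>
    have := (h.1.subsingleton_path _ _).elim ⟨.cons h1 (.cons h2 .nil), by simp [h1.ne, h2.ne, h5]⟩
      ⟨.cons h4.symm (.cons h3.symm .nil), by simp [h3.ne.symm, h4.ne.symm, h5]⟩
    have := congrArg (fun p : H.Path a c => b ∈ p.1.support) this
    simp [h1.ne.symm, h2.ne, h6] at this
  | @claw a b c d h1 h2 h3 h4 h5 h6 =>
    obtain ⟨n, ⟨e⟩⟩ := h.2 (H.connectedComponentMk a)
    have hmem : ∀ {y}, H.Adj a y → y ∈ H.connectedComponentMk a := fun hy =>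
      SimpleGraph.ConnectedComponent.sound hy.symm.reachable
    have hpos : ∀ {y} (hy : H.Adj a y),
        (e ⟨a, rfl⟩).val + 1 = (e ⟨y, hmem hy⟩).val ∨
          (e ⟨y, hmem hy⟩).val + 1 = (e ⟨a, rfl⟩).val := fun {y} hy => by
      rw [← SimpleGraph.pathGraph_adj]
      exact e.map_rel_iff.2 ((SimpleGraph.ConnectedComponent.toSimpleGraph_adj _ _ _).2 hy)
    have hne : ∀ {y z} (hy : H.Adj a y) (hz : H.Adj a z), y ≠ z →
        (e ⟨y, hmem hy⟩).val ≠ (e ⟨z, hmem hz⟩).val := fun hy hz hyz hv =>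
      hyz (congrArg Subtype.val (e.injective (Fin.ext hv)))
    have := hpos h1
    have := hpos h2
    have := hpos h3
    have := hne h1 h2 h4
    have := hne h1 h3 h5
    have := hne h2 h3 h6
    omega

theorem exists_isLongestList {V : Type u} [Finite V] (G : SimpleGraph V) :
    ∃ l, IsLongestList G l := by
  classical
  have : Fintype V := Fintype.ofFinite V
  have hfin : {n | ∃ l, IsPathList G l ∧ l.length = n}.Finite :=
    (Set.finite_Iic (Fintype.card V)).subset (by
      rintro _ ⟨l, hl, rfl⟩
      exact hl.2.length_le_card)
  obtain ⟨n, ⟨l, hl, rfl⟩, hmax⟩ := hfin.exists_maximal ⟨0, [], by simp [IsPathList], rfl⟩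
  exact ⟨l, hl, fun l' hl' => by
    by_contra! hlt
    exact absurd (hmax ⟨l', hl', rfl⟩ hlt.le) (by simpa using hlt)⟩

theorem isLinearForest_of_not_hasObstruction {V : Type u} [Finite V] {H : SimpleGraph V}
    (hV : Nat.card V ≤ 4) (h : ¬ HasObstruction H) : IsLinearForest H := by
  classical
  have : Fintype V := Fintype.ofFinite V
  rw [Nat.card_eq_fintype_card] at hV
  refine ⟨?_, fun C => ?_⟩
  · intro v w hw
    have h3 := hw.three_le_length
    have h4 : w.length ≤ 4 := by
      have := hw.support_nodup.length_le_card
      simp at this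
      omega
    have hnd := hw.support_nodup
    match w, h3, h4, hnd with
    | .cons h1 (.cons h2 (.cons h3 .nil)), _, _, _ => exact h (.triangle h1 h2 h3)
    | .cons h1 (.cons h2 (.cons h3 (.cons h4 .nil))), _, _, hnd =>
      simp only [SimpleGraph.Walk.support_cons, SimpleGraph.Walk.support_nil, List.tail_cons,
        List.nodup_cons, List.mem_cons, not_or] at hnd
      exact h (.fourCycle h1 h2 h3 h4 (fun h => hnd.2.1.2.1 h.symm) hnd.1.2.1)
  · set K := C.toSimpleGraph with hK
    have hKH : ¬ HasObstruction K := fun hobs =>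
      h (hobs.map_hom C.toSimpleGraph_hom Subtype.val_injective)
    obtain ⟨l, hl⟩ := exists_isLongestList K
    -- A vertex outside a longest path yields an attachment with three neighbours.
    have hall : ∀ x, x ∈ l := by
      intro x
      by_contra hx
      obtain ⟨D⟩ := hl.nonempty_detour C.connected_toSimpleGraph hx
      obtain ⟨t, ht⟩ := D.T_nonempty
      obtain ⟨c, hc, hct⟩ := D.exists_adj_C t ht
      obtain ⟨p, hp, hps, htp⟩ := D.exists_pred t ht
      have hcl := D.notMem_of_mem_C c hc
      exact hKH (.claw hct.symm (D.adj_succ t ht) htp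
        (fun he => hcl (he ▸ D.succ_mem t ht)) (fun he => hcl (he ▸ hp)) hps.symm)
    have hlen : l.length ≤ 4 := (hl.1.2.length_le_card).trans
      ((Fintype.card_le_of_injective _ Subtype.val_injective).trans hV)
    have hcons : ∀ i (hi : i + 1 < l.length), K.Adj l[i] l[i + 1] := fun i hi =>
      hl.1.1.getElem i hi
    have hinj : ∀ {i j : ℕ} (hi : i < l.length) (hj : j < l.length), l[i] = l[j] → i = j :=
      fun hi hj he => (hl.1.2.getElem_inj_iff).1 he
    -- A chord of the path closes a triangle or a 4-cycle.
    have hchord : ∀ i j (hi : i < l.length) (hj : j < l.length), i < j → K.Adj l[i] l[j] →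
        i + 1 = j := by
      intro i j hi hj hij hadj
      by_contra hne
      obtain rfl | rfl : j = i + 2 ∨ j = i + 3 := by omega
      · exact hKH (.triangle (hcons i (by omega)) (hcons (i + 1) hj) hadj.symm)
      · exact hKH (.fourCycle (hcons i (by omega)) (hcons (i + 1) (by omega)) (hcons (i + 2) hj)
          hadj.symm (fun he => by have := hinj _ _ he; omega)
          (fun he => by have := hinj _ _ he; omega))
    refine ⟨l.length, ⟨RelIso.symm ⟨Equiv.ofBijective l.get
      ⟨List.nodup_iff_injective_get.1 hl.1.2, fun x => ?_⟩, ?_⟩⟩⟩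
    · obtain ⟨i, hi⟩ := List.mem_iff_get.1 (hall x)
      exact ⟨i, hi⟩
    · intro i j
      rw [SimpleGraph.pathGraph_adj]
      constructor
      · intro (hadj : K.Adj l[i.val] l[j.val])
        rcases lt_trichotomy i.val j.val with hij | hij | hij
        · exact Or.inl (hchord i j i.2 j.2 hij hadj)
        · exact absurd hadj (by simp [hij])
        · exact Or.inr (hchord j i j.2 i.2 hij hadj.symm)
      · rintro (hij | hij)
        · have := hcons i (by omega)
          change K.Adj l[i.val] l[j.val]
          simpa only [hij] using this
        · have := hcons j (by omega)
          change K.Adj l[i.val] l[j.val]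
          simpa only [hij] using this.symm

/-- The adjacency matrix of a graph on four vertices, from its six entries above the diagonal. -/
def adjTable (b01 b02 b03 b12 b13 b23 : Bool) : Fin 4 → Fin 4 → Bool :=
  ![![false, b01, b02, b03], ![b01, false, b12, b13], ![b02, b12, false, b23],
    ![b03, b13, b23, false]]

theorem adjTable_classification : ∀ b01 b02 b03 b12 b13 b23 : Bool,
    let t := adjTable b01 b02 b03 b12 b13 b23
    (∃ a b c, t a b ∧ t b c ∧ t c a) ∨
    (∃ a b c d, t a b ∧ t b c ∧ t c d ∧ t d a ∧ a ≠ c ∧ b ≠ d) ∨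
    (∃ a b c d, t a b ∧ t a c ∧ t a d ∧ b ≠ c ∧ b ≠ d ∧ c ≠ d) ∨
    ∃ a b c d, a ≠ b ∧ a ≠ c ∧ a ≠ d ∧ b ≠ c ∧ b ≠ d ∧ c ≠ d ∧
      t a c = false ∧ t a d = false ∧ t b d = false := by
  decide +kernel

/-- The vertices of a graph on four vertices without obstruction can be ordered so that only
consecutive ones are possibly adjacent. -/
theorem exists_order_of_not_hasObstruction {H : SimpleGraph (Fin 4)} (h : ¬ HasObstruction H) :
    ∃ a b c d, a ≠ b ∧ a ≠ c ∧ a ≠ d ∧ b ≠ c ∧ b ≠ d ∧ c ≠ d ∧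
      ¬ H.Adj a c ∧ ¬ H.Adj a d ∧ ¬ H.Adj b d := by
  classical
  have ht : ∀ i j, H.Adj i j ↔ adjTable (decide (H.Adj 0 1)) (decide (H.Adj 0 2))
      (decide (H.Adj 0 3)) (decide (H.Adj 1 2)) (decide (H.Adj 1 3)) (decide (H.Adj 2 3)) i j := by
    intro i j
    fin_cases i <;> fin_cases j <;> simp [adjTable, H.adj_comm 1 0, H.adj_comm 2 0,
      H.adj_comm 3 0, H.adj_comm 2 1, H.adj_comm 3 1, H.adj_comm 3 2]
  obtain ⟨a, b, c, h1, h2, h3⟩ | ⟨a, b, c, d, h1, h2, h3, h4, h5, h6⟩ |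
      ⟨a, b, c, d, h1, h2, h3, h4, h5, h6⟩ | ⟨a, b, c, d, h1, h2, h3, h4, h5, h6, h7, h8, h9⟩ :=
    adjTable_classification (decide (H.Adj 0 1)) (decide (H.Adj 0 2)) (decide (H.Adj 0 3))
      (decide (H.Adj 1 2)) (decide (H.Adj 1 3)) (decide (H.Adj 2 3))
  · exact (h (.triangle ((ht _ _).2 h1) ((ht _ _).2 h2) ((ht _ _).2 h3))).elim
  · exact (h (.fourCycle ((ht _ _).2 h1) ((ht _ _).2 h2) ((ht _ _).2 h3) ((ht _ _).2 h4) h5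
      h6)).elim
  · exact (h (.claw ((ht _ _).2 h1) ((ht _ _).2 h2) ((ht _ _).2 h3) h4 h5 h6)).elim
  · refine ⟨a, b, c, d, h1, h2, h3, h4, h5, h6, fun h => ?_, fun h => ?_, fun h => ?_⟩
    · exact absurd ((ht _ _).1 h) (by rw [h7]; exact Bool.false_ne_true)
    · exact absurd ((ht _ _).1 h) (by rw [h8]; exact Bool.false_ne_true)
    · exact absurd ((ht _ _).1 h) (by rw [h9]; exact Bool.false_ne_true)

/-- A connected graph without Gallai vertex contains each spanning subgraph of the path `abcd` as an
induced subgraph: the eight choices of edges are, up to isomorphism, the five linear forests on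
four vertices. -/
theorem exists_subpath_of_forall_not_isGallaiVertex {W : Type v} [Finite W] {G : SimpleGraph W}
    (hG : G.Connected) (h : ∀ x, ¬ IsGallaiVertex G x) (p q r : Prop) :
    ∃ a b c d, a ≠ b ∧ a ≠ c ∧ a ≠ d ∧ b ≠ c ∧ b ≠ d ∧ c ≠ d ∧
      ¬ G.Adj a c ∧ ¬ G.Adj a d ∧ ¬ G.Adj b d ∧ (G.Adj a b ↔ p) ∧ (G.Adj b c ↔ q) ∧
      (G.Adj c d ↔ r) := by
  classical
  have : Fintype W := Fintype.ofFinite W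
  have : Nonempty W := hG.nonempty
  obtain ⟨x, -, hx⟩ := Finset.univ.exists_max_image (fun y : W => G.degree y)
    Finset.univ_nonempty
  have hx' : ∀ y, G.degree y ≤ G.degree x := fun y => hx y (Finset.mem_univ y)
  by_contra! hcon
  by_cases hp : p <;> by_cases hq : q <;> by_cases hr : r <;>
    simp only [hp, hq, hr, iff_true, iff_false] at hcon
  · exact h x (isGallaiVertex_of_forall_isLongestList fun l =>
      mem_of_free_pathFour hG (fun a b c d => by
        have := hcon a b c d
        have ia := G.loopless.irrefl a
        have ib := G.loopless.irrefl b
        have ic := G.loopless.irrefl c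
        have id := G.loopless.irrefl d
        clear hcon hx hx'
        grind +splitImp [SimpleGraph.adj_comm]) hx')
  · exact h x (isGallaiVertex_of_forall_isLongestList fun l =>
      mem_of_free_pathThree_add_vertex hG (fun a b c d => by
        have := hcon a b c d
        have ia := G.loopless.irrefl a
        have ib := G.loopless.irrefl b
        have ic := G.loopless.irrefl c
        have id := G.loopless.irrefl d
        clear hcon hx hx'
        grind +splitImp [SimpleGraph.adj_comm]) hx')
  · exact h x (isGallaiVertex_of_forall_isLongestList fun l =>
      mem_of_free_twoEdges hG (fun a b c d => by
        have := hcon a b c d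
        have ia := G.loopless.irrefl a
        have ib := G.loopless.irrefl b
        have ic := G.loopless.irrefl c
        have id := G.loopless.irrefl d
        clear hcon hx hx'
        grind +splitImp [SimpleGraph.adj_comm]) hx')
  · exact h x (isGallaiVertex_of_forall_isLongestList fun l =>
      mem_of_free_edge_add_two_vertices hG (fun a b c d => by
        have := hcon a b c d
        have ia := G.loopless.irrefl a
        have ib := G.loopless.irrefl b
        have ic := G.loopless.irrefl c
        have id := G.loopless.irrefl d
        clear hcon hx hx'
        grind +splitImp [SimpleGraph.adj_comm]) hx')
  · exact h x (isGallaiVertex_of_forall_isLongestList fun l =>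
      mem_of_free_pathThree_add_vertex hG (fun a b c d => by
        have := hcon d a b c
        have ia := G.loopless.irrefl a
        have ib := G.loopless.irrefl b
        have ic := G.loopless.irrefl c
        have id := G.loopless.irrefl d
        clear hcon hx hx'
        grind +splitImp [SimpleGraph.adj_comm]) hx')
  · exact h x (isGallaiVertex_of_forall_isLongestList fun l =>
      mem_of_free_edge_add_two_vertices hG (fun a b c d => by
        have := hcon c a b d
        have ia := G.loopless.irrefl a
        have ib := G.loopless.irrefl b
        have ic := G.loopless.irrefl c
        have id := G.loopless.irrefl d
        clear hcon hx hx'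
        grind +splitImp [SimpleGraph.adj_comm]) hx')
  · exact h x (isGallaiVertex_of_forall_isLongestList fun l =>
      mem_of_free_edge_add_two_vertices hG (fun a b c d => by
        have := hcon c d a b
        have ia := G.loopless.irrefl a
        have ib := G.loopless.irrefl b
        have ic := G.loopless.irrefl c
        have id := G.loopless.irrefl d
        clear hcon hx hx'
        grind +splitImp [SimpleGraph.adj_comm]) hx')
  · obtain ⟨v, hv⟩ := exists_mem_of_free_four_vertices hG (fun a b c d => by
      have := hcon a b c d
      grind)
    exact h v (isGallaiVertex_of_forall_isLongestList hv)

/-! ### Exhaustive search for long paths -/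

/-- Membership of `w` in the set of natural numbers with bit mask `vis`. -/
def visited (vis w : ℕ) : Bool :=
  Nat.beq (Nat.land (Nat.shiftRight vis w) 1) 1

/-- `hasLongPath table tgt s fuel vis cur` searches exhaustively for a path in the graph with
adjacency lists `table` that starts in `cur`, avoids the vertices in the bit mask `vis`, ends in
`tgt`, and leaves fewer than `s` of the `fuel - 1` available steps unused. The recursors are
written out so that the kernel evaluates the search quickly. -/
noncomputable def hasLongPath (table : List (List ℕ)) (tgt s fuel : ℕ) : ℕ → ℕ → Bool :=
  Nat.rec (fun _ _ => false) (fun fuel search vis cur =>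
    cond (Nat.beq cur tgt) (Nat.blt fuel s)
      (List.rec false (fun w _ rest => cond (visited vis w) rest
        (cond (search (Nat.lor vis (Nat.shiftLeft 1 w)) w) true rest)) (table.getD cur []))) fuel

theorem hasLongPath_succ (table : List (List ℕ)) (tgt s fuel vis cur : ℕ) :
    hasLongPath table tgt s (fuel + 1) vis cur =
      cond (Nat.beq cur tgt) (Nat.blt fuel s) ((table.getD cur []).any fun w =>
        !visited vis w && hasLongPath table tgt s fuel (vis ||| 1 <<< w) w) := by
  have key : ∀ l : List ℕ, (List.rec false (fun w _ rest => cond (visited vis w) rest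
        (cond (hasLongPath table tgt s fuel (Nat.lor vis (Nat.shiftLeft 1 w)) w) true rest)) l :
          Bool) = l.any fun w =>
        !visited vis w && hasLongPath table tgt s fuel (vis ||| 1 <<< w) w := by
    intro l
    induction l with
    | nil => rfl
    | cons w l ih =>
      rw [List.any_cons, ← ih]
      change cond (visited vis w) _ (cond (hasLongPath table tgt s fuel (vis ||| 1 <<< w) w)
        true _) = _
      cases visited vis w <;> cases hasLongPath table tgt s fuel (vis ||| 1 <<< w) w <;> rfl
  rw [← key]
  rfl

theorem visited_eq_testBit (vis w : ℕ) : visited vis w = vis.testBit w := by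
  rw [Nat.testBit_eq_decide_div_mod_eq, visited]
  change Nat.beq (vis >>> w &&& 1) 1 = _
  rw [Nat.and_one_is_mod, Nat.shiftRight_eq_div_pow, Bool.eq_iff_iff, Nat.beq_eq,
    decide_eq_true_iff]

theorem length_le_of_hasLongPath_eq_false (table : List (List ℕ)) (tgt s : ℕ) (l : List ℕ) :
    ∀ fuel vis cur, (cur :: l).IsChain (fun a b => b ∈ table.getD a []) → (cur :: l).Nodup →
      (∀ y ∈ l, vis.testBit y = false) → (cur :: l).getLast? = some tgt → l.length < fuel →
      hasLongPath table tgt s fuel vis cur = false → s + l.length < fuel := by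
  induction l with
  | nil =>
    intro fuel vis cur _ _ _ hlast hlen hsearch
    obtain _ | f := fuel
    · simp at hlen
    · simp only [List.getLast?_singleton, Option.some.injEq] at hlast
      subst hlast
      rw [hasLongPath_succ, Nat.beq_refl, cond_true] at hsearch
      have : ¬ f < s := fun h => by
        rw [← Nat.blt_eq] at h
        simp [h] at hsearch
      simp only [List.length_nil]
      omega
  | cons w l ih =>
    intro fuel vis cur hch hnd hvis hlast hlen hsearch
    obtain _ | f := fuel
    · simp at hlen
    · rw [List.isChain_cons_cons] at hch
      rw [List.getLast?_cons_cons] at hlast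
      have hcur : cur ≠ tgt := fun h =>
        (List.nodup_cons.1 hnd).1 (h ▸ List.mem_of_getLast? hlast)
      have hbeq : Nat.beq cur tgt = false := by
        rwa [← Bool.not_eq_true, Nat.beq_eq]
      rw [hasLongPath_succ, hbeq, cond_false, List.any_eq_false] at hsearch
      have h3 := hsearch w hch.1
      rw [visited_eq_testBit, hvis w (by simp)] at h3
      have h4 := ih f (vis ||| 1 <<< w) w hch.2 hnd.of_cons (fun y hy => ?_) hlast
        (by simpa using hlen) (by simpa using h3)
      · simp only [List.length_cons]
        omega
      · have hwy : w ≠ y := fun h => (List.nodup_cons.1 hnd.of_cons).1 (h ▸ hy)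
        rw [Nat.testBit_or, hvis y (by simp [hy]), Nat.one_shiftLeft, Nat.testBit_two_pow]
        simpa using hwy

/-- The Petersen graph without one vertex; the three neighbours of that vertex are `0, 3, 4`. -/
def petersenTable : List (List ℕ) :=
  [[1, 5], [0, 2, 6], [1, 3, 7], [2, 8], [6, 7], [0, 7, 8], [1, 4, 8], [2, 4, 5], [3, 5, 6]]

/-- The graph of `petersenTable` with each vertex `v` replaced by a triangle `3v, 3v + 1, 3v + 2`
whose corners take over the edges at `v`. -/
def inflatedTable : List (List ℕ) :=
  [[1, 2], [0, 2, 3], [0, 1, 15], [1, 4, 5], [3, 5, 6], [3, 4, 18], [4, 7, 8], [6, 8, 10],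
    [6, 7, 21], [10, 11], [7, 9, 11], [9, 10, 24], [13, 14], [12, 14, 19], [12, 13, 22],
    [2, 16, 17], [15, 17, 23], [15, 16, 25], [5, 19, 20], [13, 18, 20], [18, 19, 26],
    [8, 22, 23], [14, 21, 23], [16, 21, 22], [11, 25, 26], [17, 24, 26], [20, 24, 25]]

theorem hasLongPath_petersenTable :
    hasLongPath petersenTable 3 1 9 (1 <<< 0) 0 = false ∧
    hasLongPath petersenTable 4 1 9 (1 <<< 0) 0 = false ∧
    hasLongPath petersenTable 4 1 9 (1 <<< 3) 3 = false := by
  decide +kernel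

theorem hasLongPath_inflatedTable :
    hasLongPath inflatedTable 9 3 27 (1 <<< 0) 0 = false ∧
    hasLongPath inflatedTable 12 3 27 (1 <<< 0) 0 = false ∧
    hasLongPath inflatedTable 12 3 27 (1 <<< 9) 9 = false := by
  decide +kernel

/-! ### Attaching pendant paths -/

section Pendants

variable {A : Type} {K : SimpleGraph A} {τ : Fin 3 → A} {m : ℕ}

/-- The graph `K` with a pendant path on `m` new vertices attached at each of the three terminals
`τ t`. The vertex `(t, 0)` of a pendant path is the one adjacent to `τ t`. -/
def attachPaths (K : SimpleGraph A) (τ : Fin 3 → A) (m : ℕ) :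
    SimpleGraph (A ⊕ Fin 3 × Fin m) where
  Adj
    | .inl a, .inl b => K.Adj a b
    | .inl a, .inr p => a = τ p.1 ∧ p.2.val = 0
    | .inr p, .inl a => a = τ p.1 ∧ p.2.val = 0
    | .inr p, .inr q => p.1 = q.1 ∧ (p.2.val + 1 = q.2.val ∨ q.2.val + 1 = p.2.val)
  symm := ⟨by
    rintro (a | p) (b | q) h
    · exact K.symm.symm _ _ h
    · exact h
    · exact h
    · exact ⟨h.1.symm, h.2.symm⟩⟩
  loopless := ⟨by
    rintro (a | p) h
    · exact K.loopless.irrefl _ h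
    · omega⟩

@[simp] theorem attachPaths_adj_inl_inl {a b : A} :
    (attachPaths K τ m).Adj (.inl a) (.inl b) ↔ K.Adj a b := Iff.rfl

@[simp] theorem attachPaths_adj_inl_inr {a : A} {p : Fin 3 × Fin m} :
    (attachPaths K τ m).Adj (.inl a) (.inr p) ↔ a = τ p.1 ∧ p.2.val = 0 := Iff.rfl

@[simp] theorem attachPaths_adj_inr_inl {a : A} {p : Fin 3 × Fin m} :
    (attachPaths K τ m).Adj (.inr p) (.inl a) ↔ a = τ p.1 ∧ p.2.val = 0 := Iff.rfl

@[simp] theorem attachPaths_adj_inr_inr {p q : Fin 3 × Fin m} :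
    (attachPaths K τ m).Adj (.inr p) (.inr q) ↔
      p.1 = q.1 ∧ (p.2.val + 1 = q.2.val ∨ q.2.val + 1 = p.2.val) := Iff.rfl

/-- The vertex set of the pendant path at `τ t`. -/
def pendant (A : Type) (m : ℕ) (t : Fin 3) : Set (A ⊕ Fin 3 × Fin m) :=
  {x | ∃ i, x = .inr (t, i)}

/-- Only the terminal `τ t` gives access to the pendant path at `τ t`. -/
theorem eq_of_adj_of_mem_pendant {t : Fin 3} {x y : A ⊕ Fin 3 × Fin m} (hx : x ∈ pendant A m t)
    (hxy : (attachPaths K τ m).Adj x y) (hy : y ∉ pendant A m t) : y = .inl (τ t) := by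
  obtain ⟨i, rfl⟩ := hx
  obtain a | ⟨s, j⟩ := y
  · rw [(attachPaths_adj_inr_inl.1 hxy).1]
  · obtain rfl : t = s := (attachPaths_adj_inr_inr.1 hxy).1
    exact (hy ⟨j, rfl⟩).elim

theorem subset_pendant_of_isChain {t : Fin 3} (l : List (A ⊕ Fin 3 × Fin m)) :
    ∀ x ∈ pendant A m t, (x :: l).IsChain (attachPaths K τ m).Adj → .inl (τ t) ∉ l →
      ∀ y ∈ x :: l, y ∈ pendant A m t := by
  induction l with
  | nil =>
    intro x hx _ _ y hy
    exact List.mem_singleton.1 hy ▸ hx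
  | cons z l ih =>
    intro x hx hch hl y hy
    rw [List.isChain_cons_cons] at hch
    have hz : z ∈ pendant A m t := by
      by_contra hz
      exact hl (eq_of_adj_of_mem_pendant hx hch.1 hz ▸ List.mem_cons_self)
    obtain rfl | hy := List.mem_cons.1 hy
    · exact hx
    · exact ih z hz hch.2 (fun h => hl (List.mem_cons_of_mem _ h)) y hy

/-- A path that meets a pendant path has an end on it. -/
theorem head_or_getLast_mem_pendant {t : Fin 3} {l : List (A ⊕ Fin 3 × Fin m)}
    (hl : IsPathList (attachPaths K τ m) l) {x : A ⊕ Fin 3 × Fin m} (hxl : x ∈ l)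
    (hx : x ∈ pendant A m t) :
    (∃ y ∈ l.head?, y ∈ pendant A m t) ∨ ∃ y ∈ l.getLast?, y ∈ pendant A m t := by
  obtain ⟨u, w, rfl⟩ := List.append_of_mem hxl
  by_cases hw : .inl (τ t) ∈ w
  · left
    have hu : .inl (τ t) ∉ u := fun hu =>
      (List.nodup_append.1 hl.2).2.2 _ hu _ (List.mem_cons_of_mem _ hw) rfl
    have hch := hl.reverse.1
    rw [List.reverse_append, List.reverse_cons, List.append_assoc, List.isChain_append] at hch
    have hsub := subset_pendant_of_isChain u.reverse x hx hch.2.1 (by simpa using hu)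
    obtain _ | ⟨z, u⟩ := u
    · exact ⟨x, rfl, hx⟩
    · exact ⟨z, rfl, hsub z (by simp)⟩
  · right
    have hch := (List.isChain_append.1 hl.1).2.1
    have hsub := subset_pendant_of_isChain w x hx hch hw
    refine ⟨(x :: w).getLast (by simp), ?_, hsub _ (List.getLast_mem _)⟩
    rw [List.getLast?_append_of_ne_nil _ (by simp), List.getLast?_eq_some_getLast (by simp)]
    rfl

/-- A path that starts on the pendant path at `τ s` and ends elsewhere leaves the pendant path
for good through `τ s`. -/
theorem exists_eq_append_of_head_mem_pendant {s : Fin 3} {l : List (A ⊕ Fin 3 × Fin m)}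
    (hl : IsPathList (attachPaths K τ m) l) (hhead : ∃ y ∈ l.head?, y ∈ pendant A m s)
    (hlast : ∃ y ∈ l.getLast?, y ∉ pendant A m s) :
    ∃ u w, l = u ++ .inl (τ s) :: w ∧ u.length ≤ m ∧ ∀ y ∈ w, y ∉ pendant A m s := by
  have hmem : .inl (τ s) ∈ l := by
    by_contra hmem
    obtain _ | ⟨x, l⟩ := l
    · simp at hhead
    · simp only [List.head?_cons, Option.mem_some_iff, exists_eq_left'] at hhead
      obtain ⟨y, hy, hys⟩ := hlast
      exact hys (subset_pendant_of_isChain l x hhead hl.1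
        (fun h => hmem (List.mem_cons_of_mem _ h)) y (List.mem_of_getLast? hy))
  obtain ⟨u, w, rfl⟩ := List.append_of_mem hmem
  have hnd := List.nodup_append.1 hl.2
  have hnu : .inl (τ s) ∉ u := fun h => hnd.2.2 _ h _ List.mem_cons_self rfl
  have hnw : .inl (τ s) ∉ w := (List.nodup_cons.1 hnd.2.1).1
  have hu : ∀ y ∈ u, y ∈ pendant A m s := by
    obtain _ | ⟨x, u⟩ := u
    · simp
    · simp only [List.cons_append, List.head?_cons, Option.mem_some_iff, exists_eq_left'] at hhead
      exact subset_pendant_of_isChain u x hhead (List.isChain_append.1 hl.1).1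
        (fun h => hnu (List.mem_cons_of_mem _ h))
  refine ⟨u, w, rfl, ?_, fun y hy hys => ?_⟩
  · classical
    have hsub : u.toFinset ⊆ (Finset.univ : Finset (Fin m)).image fun i => .inr (s, i) := by
      intro y hy
      obtain ⟨i, rfl⟩ := hu y (List.mem_toFinset.1 hy)
      simp
    have := (Finset.card_le_card hsub).trans Finset.card_image_le
    rwa [List.toFinset_card_of_nodup hnd.1, Finset.card_univ, Fintype.card_fin] at this
  · obtain ⟨p, q, rfl⟩ := List.append_of_mem hy
    obtain ⟨z, hz, hzs⟩ := hlast
    have hch := (List.isChain_append.1 (List.isChain_append.1 hl.1).2.1.of_cons).2.1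
    have hsub := subset_pendant_of_isChain q y hys hch (fun h => hnw (by simp [h]))
    rw [List.getLast?_append_of_ne_nil _ (by simp), ← List.cons_append,
      List.getLast?_append_of_ne_nil _ (by simp)] at hz
    exact hzs (hsub z (List.mem_of_getLast? hz))

/-- The paths of `K` between distinct terminals have at most `L` vertices; those with exactly `L`
vertices have no common vertex, and no terminal is an end of all of them. -/
structure IsGallaiCore (K : SimpleGraph A) (τ : Fin 3 → A) (L : ℕ) : Prop where
  length_le : ∀ s t, s ≠ t → ∀ q, IsPathList K q → q.head? = some (τ s) →
    q.getLast? = some (τ t) → q.length ≤ L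
  exists_notMem : ∀ a, ∃ s t q, s ≠ t ∧ IsPathList K q ∧ q.head? = some (τ s) ∧
    q.getLast? = some (τ t) ∧ q.length = L ∧ a ∉ q
  exists_ne : ∀ r, ∃ s t q, s ≠ t ∧ s ≠ r ∧ t ≠ r ∧ IsPathList K q ∧ q.head? = some (τ s) ∧
    q.getLast? = some (τ t) ∧ q.length = L

/-- If the pendant paths are long compared with `K`, then no path is longer than an extremal path
between two terminals extended along their pendant paths: a path that meets at most one pendant
path is too short, and one that meets two of them has an end on each. -/
theorem IsGallaiCore.length_le_attachPaths [Fintype A] {L : ℕ} (hK : IsGallaiCore K τ L)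
    (hm : Fintype.card A ≤ L + m) {l : List (A ⊕ Fin 3 × Fin m)}
    (hl : IsPathList (attachPaths K τ m) l) : l.length ≤ L + 2 * m := by
  classical
  by_cases hends : ∃ s t, s ≠ t ∧ (∃ y ∈ l.head?, y ∈ pendant A m s) ∧
      ∃ y ∈ l.getLast?, y ∈ pendant A m t
  · obtain ⟨s, t, hst, hhead, hlast⟩ := hends
    have hdisj : ∀ {r r'} {y}, r ≠ r' → y ∈ pendant A m r → y ∉ pendant A m r' := by
      rintro r r' _ hrr ⟨i, rfl⟩ ⟨j, hj⟩
      simp only [Sum.inr.injEq, Prod.mk.injEq] at hj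
      exact hrr hj.1
    have honly : ∀ x ∈ l, ∀ r, r ≠ s → r ≠ t → x ∉ pendant A m r := by
      intro x hx r hrs hrt hxr
      obtain ⟨y, hy, hyr⟩ | ⟨y, hy, hyr⟩ := head_or_getLast_mem_pendant hl hx hxr
      · obtain ⟨z, hz, hzs⟩ := hhead
        exact hdisj hrs hyr (Option.mem_unique hz hy ▸ hzs)
      · obtain ⟨z, hz, hzs⟩ := hlast
        exact hdisj hrt hyr (Option.mem_unique hz hy ▸ hzs)
    obtain ⟨u, w, rfl, hu, hw⟩ := exists_eq_append_of_head_mem_pendant hl hhead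
      (hlast.imp fun y hy => ⟨hy.1, hdisj hst.symm hy.2⟩)
    have hl2 : IsPathList (attachPaths K τ m) (.inl (τ s) :: w) :=
      ⟨(List.isChain_append.1 hl.1).2.1, (List.nodup_append.1 hl.2).2.1⟩
    rw [List.getLast?_append_of_ne_nil _ (by simp)] at hlast
    obtain ⟨u', w', he, hu', hw'⟩ := exists_eq_append_of_head_mem_pendant hl2.reverse
      (by rwa [List.head?_reverse])
      ⟨.inl (τ s), by rw [List.getLast?_reverse]; rfl, by rintro ⟨i, hi⟩; simp at hi⟩
    have hl3 : IsPathList (attachPaths K τ m) (.inl (τ t) :: w') := by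
      have := hl2.reverse
      rw [he] at this
      exact ⟨(List.isChain_append.1 this.1).2.1, (List.nodup_append.1 this.2).2.1⟩
    have hmem : ∀ y ∈ .inl (τ t) :: w', y ∈ .inl (τ s) :: w := by
      intro y hy
      rw [← List.mem_reverse, he]
      exact List.mem_append_right _ hy
    have hcore : ∀ y ∈ .inl (τ t) :: w', ∃ a, Sum.inl a = y := by
      rintro (a | ⟨r, i⟩) hy
      · exact ⟨a, rfl⟩
      · exfalso
        have hyr : .inr (r, i) ∈ pendant A m r := ⟨i, rfl⟩
        by_cases hrt : r = t
        · subst hrt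
          exact hw' _ ((List.mem_cons.1 hy).resolve_left (by simp)) hyr
        by_cases hrs : r = s
        · subst hrs
          exact hw _ ((List.mem_cons.1 (hmem _ hy)).resolve_left (by simp)) hyr
        exact honly _ (List.mem_append_right _ (hmem _ hy)) r hrs hrt hyr
    obtain ⟨c, hc⟩ : ∃ c : List A, c.map Sum.inl = .inl (τ t) :: w' :=
      (Set.ext_iff.1 (Set.range_list_map Sum.inl) _).2 hcore
    rw [← hc] at hl3 he
    have hcpath : IsPathList K c := by
      refine ⟨?_, List.Nodup.of_map _ hl3.2⟩
      have := hl3.1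
      rw [List.isChain_map] at this
      exact this
    have hc1 : c.head? = some (τ t) := by
      have := congrArg List.head? hc
      rw [List.head?_map] at this
      simpa using this
    have hcne : c ≠ [] := by rintro rfl; simp at hc1
    have hc2 : c.getLast? = some (τ s) := by
      have := congrArg List.getLast? he
      rw [List.getLast?_append_of_ne_nil _ (by simpa using hcne), List.getLast?_map,
        List.getLast?_reverse] at this
      simpa using this.symm
    have h1 := hK.length_le t s hst.symm c hcpath hc1 hc2
    have h2 := congrArg List.length he
    simp only [List.length_append, List.length_reverse, List.length_map, List.length_cons] at h2 ⊢
    omega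
  · -- All pendant vertices of the path lie on a single pendant path.
    obtain ⟨s, hs⟩ : ∃ s, ∀ x ∈ l, ∀ r, x ∈ pendant A m r → r = s := by
      by_contra! hcon
      obtain ⟨x, hx, r, hxr, -⟩ := hcon 0
      obtain ⟨y, hy, r', hyr, hne⟩ := hcon r
      obtain hx | hx := head_or_getLast_mem_pendant hl hx hxr <;>
        obtain hy | hy := head_or_getLast_mem_pendant hl hy hyr
      · obtain ⟨a, ha, i, rfl⟩ := hx
        obtain ⟨b, hb, j, rfl⟩ := hy
        have := Option.mem_unique ha hb
        simp only [Sum.inr.injEq, Prod.mk.injEq] at this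
        exact hne this.1.symm
      · exact hends ⟨r, r', hne.symm, hx, hy⟩
      · exact hends ⟨r', r, hne, hy, hx⟩
      · obtain ⟨a, ha, i, rfl⟩ := hx
        obtain ⟨b, hb, j, rfl⟩ := hy
        have := Option.mem_unique ha hb
        simp only [Sum.inr.injEq, Prod.mk.injEq] at this
        exact hne this.1.symm
    have hsub : l.toFinset ⊆ (Finset.univ : Finset A).image Sum.inl ∪
        (Finset.univ : Finset (Fin m)).image fun i => .inr (s, i) := by
      rintro (a | ⟨r, i⟩) hy
      · simp
      · obtain rfl := hs _ (List.mem_toFinset.1 hy) r ⟨i, rfl⟩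
        simp
    have h1 := (Finset.card_le_card hsub).trans (Finset.card_union_le _ _)
    have h2 : ((Finset.univ : Finset A).image (Sum.inl (β := Fin 3 × Fin m))).card ≤
      Fintype.card A := Finset.card_image_le
    have h3 : ((Finset.univ : Finset (Fin m)).image
      fun i => (.inr (s, i) : A ⊕ Fin 3 × Fin m)).card ≤ Fintype.card (Fin m) :=
        Finset.card_image_le
    rw [List.toFinset_card_of_nodup hl.2] at h1
    rw [Fintype.card_fin] at h3
    omega

/-- The vertices of the pendant path at `τ t`, starting next to `τ t`. -/
def pendantList (A : Type) (m : ℕ) (t : Fin 3) : List (A ⊕ Fin 3 × Fin m) :=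
  (List.finRange m).map fun i => .inr (t, i)

theorem isPathList_pendantList (t : Fin 3) :
    IsPathList (attachPaths K τ m) (pendantList A m t) := by
  constructor
  · rw [List.isChain_iff_getElem]
    intro i hi
    simp [pendantList]
  · exact (List.nodup_finRange m).map fun i j h => by simpa using h

/-- A path of `K` between distinct terminals extends along both pendant paths. -/
theorem isPathList_extend {s t : Fin 3} (hst : s ≠ t) {q : List A} (hq : IsPathList K q)
    (hs : q.head? = some (τ s)) (ht : q.getLast? = some (τ t)) :
    IsPathList (attachPaths K τ m)
      ((pendantList A m s).reverse ++ (q.map Sum.inl ++ pendantList A m t)) := by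
  have hne : q ≠ [] := by rintro rfl; simp at hs
  have hhead : ∀ {r y}, y ∈ (pendantList A m r).head? → ∃ i : Fin m, i.val = 0 ∧
      y = .inr (r, i) := by
    intro r y hy
    obtain _ | m := m
    · simp [pendantList] at hy
    · simp [pendantList, List.finRange_succ] at hy
      exact ⟨0, rfl, hy.symm⟩
  constructor
  · rw [List.isChain_append, List.isChain_append]
    refine ⟨(isPathList_pendantList s).reverse.1, ⟨?_, (isPathList_pendantList t).1, ?_⟩, ?_⟩
    · rw [List.isChain_map]
      exact hq.1
    · intro x hx y hy
      rw [List.getLast?_map, ht] at hx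
      obtain ⟨i, hi, rfl⟩ := hhead hy
      simp at hx
      subst hx
      exact ⟨rfl, hi⟩
    · intro y hy x hx
      rw [List.getLast?_reverse] at hy
      rw [List.head?_append_of_ne_nil _ (by simpa using hne), List.head?_map, hs] at hx
      obtain ⟨i, hi, rfl⟩ := hhead hy
      simp at hx
      subst hx
      exact ⟨rfl, hi⟩
  · rw [List.nodup_append, List.nodup_append]
    refine ⟨(isPathList_pendantList (K := K) (τ := τ) s).reverse.2,
      ⟨hq.2.map Sum.inl_injective, (isPathList_pendantList (K := K) (τ := τ) t).2, ?_⟩, ?_⟩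
    · intro x hx y hy hxy
      obtain ⟨a, -, rfl⟩ := List.mem_map.1 hx
      obtain ⟨i, -, rfl⟩ := List.mem_map.1 hy
      simp at hxy
    · intro x hx y hy hxy
      rw [List.mem_reverse] at hx
      obtain ⟨i, -, rfl⟩ := List.mem_map.1 hx
      obtain hy | hy := List.mem_append.1 hy
      · obtain ⟨a, -, rfl⟩ := List.mem_map.1 hy
        simp at hxy
      · obtain ⟨j, -, rfl⟩ := List.mem_map.1 hy
        simp only [Sum.inr.injEq, Prod.mk.injEq] at hxy
        exact hst hxy.1

theorem IsGallaiCore.exists_isLongestList_notMem [Fintype A] {L : ℕ} (hK : IsGallaiCore K τ L)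
    (hm : Fintype.card A ≤ L + m) (x : A ⊕ Fin 3 × Fin m) :
    ∃ l, IsLongestList (attachPaths K τ m) l ∧ x ∉ l := by
  have hlong : ∀ {s t q}, s ≠ t → IsPathList K q → q.head? = some (τ s) →
      q.getLast? = some (τ t) → q.length = L → IsLongestList (attachPaths K τ m)
        ((pendantList A m s).reverse ++ (q.map Sum.inl ++ pendantList A m t)) := by
    intro s t q hst hq h1 h2 h3
    refine ⟨isPathList_extend hst hq h1 h2, fun l' hl' => ?_⟩
    have := hK.length_le_attachPaths hm hl'
    simp [pendantList]
    omega
  obtain a | ⟨r, i⟩ := x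
  · obtain ⟨s, t, q, hst, hq, h1, h2, h3, ha⟩ := hK.exists_notMem a
    refine ⟨_, hlong hst hq h1 h2 h3, ?_⟩
    simpa [pendantList] using ha
  · obtain ⟨s, t, q, hst, hsr, htr, hq, h1, h2, h3⟩ := hK.exists_ne r
    refine ⟨_, hlong hst hq h1 h2 h3, ?_⟩
    simp [pendantList, hsr, htr]

theorem connected_attachPaths (hK : K.Connected) : (attachPaths K τ m).Connected := by
  have hinl : ∀ a b, (attachPaths K τ m).Reachable (.inl a) (.inl b) := fun a b =>
    (hK.preconnected a b).map ⟨Sum.inl, fun h => h⟩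
  have hinr : ∀ t (i : ℕ) (hi : i < m),
      (attachPaths K τ m).Reachable (.inl (τ t)) (.inr (t, ⟨i, hi⟩)) := by
    intro t i
    induction i with
    | zero => exact fun hi => SimpleGraph.Adj.reachable (by simp)
    | succ i ih => exact fun hi => (ih (by omega)).trans (SimpleGraph.Adj.reachable (by simp))
  have h0 : ∀ x, (attachPaths K τ m).Reachable (.inl (τ 0)) x := by
    rintro (a | ⟨t, i, hi⟩)
    · exact hinl _ _
    · exact (hinl _ (τ t)).trans (hinr t i hi)
  have : Nonempty (A ⊕ Fin 3 × Fin m) := ⟨.inl (τ 0)⟩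
  exact ⟨fun x y => (h0 x).symm.trans (h0 y)⟩

end Pendants

/-! ### The counterexamples -/

/-- The graph on `Fin n` with the given adjacency lists. -/
def tableGraph (table : List (List ℕ)) (n : ℕ)
    (hsymm : ∀ i j : Fin n, j.val ∈ table.getD i.val [] → i.val ∈ table.getD j.val [])
    (hloop : ∀ i : Fin n, i.val ∉ table.getD i.val []) : SimpleGraph (Fin n) where
  Adj i j := j.val ∈ table.getD i.val []
  symm := ⟨hsymm⟩
  loopless := ⟨hloop⟩

instance (table : List (List ℕ)) (n : ℕ) (hsymm hloop) :
    DecidableRel (tableGraph table n hsymm hloop).Adj := fun i j =>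
  inferInstanceAs (Decidable (j.val ∈ table.getD i.val []))

theorem length_le_of_hasLongPath_tableGraph {table : List (List ℕ)} {n s : ℕ} {hsymm hloop}
    {a b : Fin n} (hsearch : hasLongPath table b s n (1 <<< a.val) a = false) {q : List (Fin n)}
    (hq : IsPathList (tableGraph table n hsymm hloop) q) (ha : q.head? = some a)
    (hb : q.getLast? = some b) : q.length + s ≤ n := by
  obtain _ | ⟨a', r⟩ := q
  · simp at ha
  obtain rfl : a' = a := by simpa using ha
  have hlen := hq.2.length_le_card
  rw [Fintype.card_fin, List.length_cons] at hlen
  have hnd : ((a' :: r).map Fin.val).Nodup := hq.2.map Fin.val_injective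
  have := length_le_of_hasLongPath_eq_false table b s (r.map Fin.val) n (1 <<< a'.val) a'
    (by
      rw [← List.map_cons, List.isChain_map]
      exact hq.1)
    hnd
    (fun y hy => by
      have hne : a'.val ≠ y := fun h => (List.nodup_cons.1 hnd).1 (h ▸ hy)
      rw [Nat.one_shiftLeft, Nat.testBit_two_pow]
      simpa using hne)
    (by rw [← List.map_cons, List.getLast?_map, hb]; rfl)
    (by rw [List.length_map]; omega) hsearch
  rw [List.length_map] at this
  rw [List.length_cons]
  omega

/-- A way to verify `IsGallaiCore`: searches for the three pairs of terminals bound the length of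
the paths, and a list of paths of the extremal length is provided. -/
theorem isGallaiCore_tableGraph {table : List (List ℕ)} {n s : ℕ} {hsymm hloop}
    {τ : Fin 3 → Fin n}
    (h01 : hasLongPath table (τ 1) s n (1 <<< (τ 0).val) (τ 0) = false)
    (h02 : hasLongPath table (τ 2) s n (1 <<< (τ 0).val) (τ 0) = false)
    (h12 : hasLongPath table (τ 2) s n (1 <<< (τ 1).val) (τ 1) = false)
    (ws : List (Fin 3 × Fin 3 × List (Fin n)))
    (hws : ∀ w ∈ ws, w.1 ≠ w.2.1 ∧ (w.2.2.IsChain (tableGraph table n hsymm hloop).Adj ∧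
      w.2.2.Nodup) ∧ w.2.2.head? = some (τ w.1) ∧ w.2.2.getLast? = some (τ w.2.1) ∧
      w.2.2.length = n - s)
    (hmiss : ∀ a, ∃ w ∈ ws, a ∉ w.2.2) (hne : ∀ r, ∃ w ∈ ws, w.1 ≠ r ∧ w.2.1 ≠ r) :
    IsGallaiCore (tableGraph table n hsymm hloop) τ (n - s) where
  length_le i j hij q hq hi hj := by
    have key : ∀ {i j}, hasLongPath table (τ j) s n (1 <<< (τ i).val) (τ i) = false → ∀ q,
        IsPathList (tableGraph table n hsymm hloop) q →
        (q.head? = some (τ i) ∧ q.getLast? = some (τ j) ∨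
          q.head? = some (τ j) ∧ q.getLast? = some (τ i)) → q.length ≤ n - s := by
      rintro i j h q hq (⟨hi, hj⟩ | ⟨hj, hi⟩)
      · have := length_le_of_hasLongPath_tableGraph h hq hi hj
        omega
      · have := length_le_of_hasLongPath_tableGraph h hq.reverse (by rwa [List.head?_reverse])
          (by rwa [List.getLast?_reverse])
        rw [List.length_reverse] at this
        omega
    fin_cases i <;> fin_cases j
    · exact absurd rfl hij
    · exact key h01 q hq (Or.inl ⟨hi, hj⟩)
    · exact key h02 q hq (Or.inl ⟨hi, hj⟩)
    · exact key h01 q hq (Or.inr ⟨hi, hj⟩)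
    · exact absurd rfl hij
    · exact key h12 q hq (Or.inl ⟨hi, hj⟩)
    · exact key h02 q hq (Or.inr ⟨hi, hj⟩)
    · exact key h12 q hq (Or.inr ⟨hi, hj⟩)
    · exact absurd rfl hij
  exists_notMem a := by
    obtain ⟨w, hw, ha⟩ := hmiss a
    obtain ⟨h1, h2, h3, h4, h5⟩ := hws w hw
    exact ⟨w.1, w.2.1, w.2.2, h1, h2, h3, h4, h5, ha⟩
  exists_ne r := by
    obtain ⟨w, hw, ha, ha'⟩ := hne r
    obtain ⟨h1, h2, h3, h4, h5⟩ := hws w hw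
    exact ⟨w.1, w.2.1, w.2.2, h1, ha, ha', h2, h3, h4, h5⟩

theorem connected_of_isChain {V : Type u} {G : SimpleGraph V} {l : List V} (hne : l ≠ [])
    (hl : l.IsChain G.Adj) (hall : ∀ x, x ∈ l) : G.Connected := by
  have key : ∀ (l : List V) (a : V), (a :: l).IsChain G.Adj → ∀ y ∈ a :: l, G.Reachable a y := by
    intro l
    induction l with
    | nil =>
      intro a _ y hy
      rw [List.mem_singleton.1 hy]
    | cons b l ih =>
      intro a hl y hy
      rw [List.isChain_cons_cons] at hl
      obtain rfl | hy := List.mem_cons.1 hy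
      · rfl
      · exact hl.1.reachable.trans (ih b hl.2 y hy)
  obtain _ | ⟨a, l⟩ := l
  · exact absurd rfl hne
  · have : Nonempty V := ⟨a⟩
    exact ⟨fun x y => (key l a hl x (hall x)).symm.trans (key l a hl y (hall y))⟩

/-- The Petersen graph without one vertex. -/
def petersenCore : SimpleGraph (Fin 9) :=
  tableGraph petersenTable 9 (by decide +kernel) (by decide +kernel)

/-- The Petersen graph without one vertex, with each vertex replaced by a triangle. -/
def inflatedCore : SimpleGraph (Fin 27) :=
  tableGraph inflatedTable 27 (by decide +kernel) (by decide +kernel)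

instance : DecidableRel petersenCore.Adj :=
  inferInstanceAs (DecidableRel (tableGraph _ _ _ _).Adj)

instance : DecidableRel inflatedCore.Adj :=
  inferInstanceAs (DecidableRel (tableGraph _ _ _ _).Adj)

/-- The former neighbours of the vertex deleted from the Petersen graph. -/
def petersenTerminal : Fin 3 → Fin 9 := ![0, 3, 4]

/-- The corners that lost their outside neighbour when a vertex of the Petersen graph was
deleted. -/
def inflatedTerminal : Fin 3 → Fin 27 := ![0, 9, 12]

/-- Since the Petersen graph is not Hamiltonian, the paths between two terminals miss a vertex;
since it is hypohamiltonian, they can miss any prescribed one. -/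
theorem isGallaiCore_petersenCore : IsGallaiCore petersenCore petersenTerminal 8 :=
  isGallaiCore_tableGraph (s := 1) hasLongPath_petersenTable.1 hasLongPath_petersenTable.2.1
    hasLongPath_petersenTable.2.2
    [(1, 2, [3, 2, 1, 6, 8, 5, 7, 4]), (0, 1, [0, 5, 8, 6, 4, 7, 2, 3]),
      (0, 1, [0, 1, 6, 4, 7, 5, 8, 3]), (0, 2, [0, 1, 2, 7, 5, 8, 6, 4]),
      (0, 1, [0, 1, 6, 8, 5, 7, 2, 3]), (0, 1, [0, 1, 2, 7, 4, 6, 8, 3]),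
      (0, 2, [0, 1, 2, 3, 8, 5, 7, 4]), (0, 2, [0, 5, 8, 3, 2, 1, 6, 4]),
      (0, 1, [0, 5, 7, 4, 6, 1, 2, 3])]
    (by decide +kernel) (by decide +kernel) (by decide +kernel)

/-- The extremal paths are those of `petersenCore`, run through all corners of each triangle. -/
theorem isGallaiCore_inflatedCore : IsGallaiCore inflatedCore inflatedTerminal 24 :=
  isGallaiCore_tableGraph (s := 3) hasLongPath_inflatedTable.1 hasLongPath_inflatedTable.2.1
    hasLongPath_inflatedTable.2.2
    [(1, 2, [9, 11, 10, 7, 8, 6, 4, 3, 5, 18, 19, 20, 26, 24, 25, 17, 15, 16, 23, 21, 22, 14, 13,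
        12]),
      (0, 1, [0, 1, 2, 15, 16, 17, 25, 24, 26, 20, 18, 19, 13, 12, 14, 22, 23, 21, 8, 6, 7, 10, 11,
        9]),
      (0, 1, [0, 2, 1, 3, 4, 5, 18, 20, 19, 13, 12, 14, 22, 21, 23, 16, 15, 17, 25, 26, 24, 11, 10,
        9]),
      (0, 2, [0, 2, 1, 3, 5, 4, 6, 7, 8, 21, 22, 23, 16, 15, 17, 25, 24, 26, 20, 18, 19, 13, 14,
        12]),
      (0, 1, [0, 2, 1, 3, 4, 5, 18, 19, 20, 26, 24, 25, 17, 15, 16, 23, 22, 21, 8, 6, 7, 10, 11,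
        9]),
      (0, 1, [0, 2, 1, 3, 5, 4, 6, 7, 8, 21, 23, 22, 14, 12, 13, 19, 18, 20, 26, 25, 24, 11, 10,
        9]),
      (0, 2, [0, 2, 1, 3, 5, 4, 6, 8, 7, 10, 9, 11, 24, 26, 25, 17, 15, 16, 23, 21, 22, 14, 13,
        12]),
      (0, 2, [0, 1, 2, 15, 16, 17, 25, 26, 24, 11, 9, 10, 7, 8, 6, 4, 3, 5, 18, 20, 19, 13, 14,
        12]),
      (0, 1, [0, 1, 2, 15, 17, 16, 23, 21, 22, 14, 12, 13, 19, 20, 18, 5, 3, 4, 6, 8, 7, 10, 11,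
        9])]
    (by decide +kernel) (by decide +kernel) (by decide +kernel)

theorem connected_petersenCore : petersenCore.Connected :=
  connected_of_isChain (l := [0, 1, 2, 3, 8, 5, 7, 4, 6]) (by simp) (by decide +kernel)
    (by decide +kernel)

theorem connected_inflatedCore : inflatedCore.Connected :=
  connected_of_isChain (l := [0, 2, 1, 3, 5, 4, 6, 8, 7, 10, 9, 11, 24, 26, 25, 17, 15, 16, 23, 21,
    22, 14, 12, 13, 19, 18, 20]) (by simp) (by decide +kernel) (by decide +kernel)

theorem petersenCore_triangle_free : ∀ a b, petersenCore.Adj a b → ∀ c, petersenCore.Adj b c →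
    ¬ petersenCore.Adj c a := by
  decide +kernel

theorem petersenCore_fourCycle_free : ∀ a b, petersenCore.Adj a b → ∀ c, petersenCore.Adj b c →
    a ≠ c → ∀ d, petersenCore.Adj c d → petersenCore.Adj d a → b = d := by
  decide +kernel

set_option synthInstance.maxSize 1000 in
theorem inflatedCore_claw_free : ∀ x a, inflatedCore.Adj x a → ∀ b, inflatedCore.Adj x b → a ≠ b →
    ∀ c, inflatedCore.Adj x c → a ≠ c → b ≠ c →
      inflatedCore.Adj a b ∨ inflatedCore.Adj a c ∨ inflatedCore.Adj b c := by
  decide +kernel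

theorem inflatedCore_simplicial : ∀ t a, inflatedCore.Adj (inflatedTerminal t) a →
    ∀ b, inflatedCore.Adj (inflatedTerminal t) b → a ≠ b → inflatedCore.Adj a b := by
  decide +kernel

section Pendants

variable {A : Type} {K : SimpleGraph A} {τ : Fin 3 → A} {m : ℕ}

/-- A pendant vertex has a single neighbour, hence lies on no cycle. -/
theorem eq_of_attachPaths_one_adj_inr {x y : A ⊕ Fin 3 × Fin 1} {p : Fin 3 × Fin 1}
    (hx : (attachPaths K τ 1).Adj x (.inr p)) (hy : (attachPaths K τ 1).Adj y (.inr p)) :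
    x = y := by
  obtain a | q := x <;> obtain b | r := y
  · rw [attachPaths_adj_inl_inr] at hx hy
    rw [hx.1, hy.1]
  all_goals
    simp only [attachPaths_adj_inl_inr, attachPaths_adj_inr_inr] at hx hy
    omega

theorem attachPaths_one_triangle_free (h3 : ∀ a b, K.Adj a b → ∀ c, K.Adj b c → ¬ K.Adj c a)
    {a b c : A ⊕ Fin 3 × Fin 1} (hab : (attachPaths K τ 1).Adj a b)
    (hbc : (attachPaths K τ 1).Adj b c) (hca : (attachPaths K τ 1).Adj c a) : False := by
  obtain a | p := a
  · obtain b | p := b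
    · obtain c | p := c
      · exact h3 a b hab c hbc hca
      · exact hab.ne (eq_of_attachPaths_one_adj_inr hbc hca.symm).symm
    · exact hca.ne (eq_of_attachPaths_one_adj_inr hab hbc.symm).symm
  · exact hbc.ne (eq_of_attachPaths_one_adj_inr hca hab.symm).symm

theorem attachPaths_one_fourCycle_free
    (h4 : ∀ a b, K.Adj a b → ∀ c, K.Adj b c → a ≠ c → ∀ d, K.Adj c d → K.Adj d a → b = d)
    {a b c d : A ⊕ Fin 3 × Fin 1} (hab : (attachPaths K τ 1).Adj a b)
    (hbc : (attachPaths K τ 1).Adj b c) (hcd : (attachPaths K τ 1).Adj c d)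
    (hda : (attachPaths K τ 1).Adj d a) (hac : a ≠ c) (hbd : b ≠ d) : False := by
  obtain a | p := a
  · obtain b | p := b
    · obtain c | p := c
      · obtain d | p := d
        · exact hbd (congrArg _ (h4 a b hab c hbc (fun h => hac (congrArg _ h)) d hcd hda))
        · exact hac (eq_of_attachPaths_one_adj_inr hcd hda.symm).symm
      · exact hbd (eq_of_attachPaths_one_adj_inr hbc hcd.symm)
    · exact hac (eq_of_attachPaths_one_adj_inr hab hbc.symm)
  · exact hbd (eq_of_attachPaths_one_adj_inr hab.symm hda)

theorem attachPaths_claw_free (hτ : Function.Injective τ)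
    (hclaw : ∀ x a, K.Adj x a → ∀ b, K.Adj x b → a ≠ b → ∀ c, K.Adj x c → a ≠ c → b ≠ c →
      K.Adj a b ∨ K.Adj a c ∨ K.Adj b c)
    (hsimp : ∀ t a, K.Adj (τ t) a → ∀ b, K.Adj (τ t) b → a ≠ b → K.Adj a b)
    {x a b c : A ⊕ Fin 3 × Fin m} (ha : (attachPaths K τ m).Adj x a)
    (hb : (attachPaths K τ m).Adj x b) (hc : (attachPaths K τ m).Adj x c) (hab : a ≠ b)
    (hac : a ≠ c) (hbc : b ≠ c) : (attachPaths K τ m).Adj a b ∨ (attachPaths K τ m).Adj a c ∨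
      (attachPaths K τ m).Adj b c := by
  have hext : ∀ {p q : Fin 3 × Fin m}, p.1 = q.1 → p.2.val = q.2.val →
      (Sum.inr p : A ⊕ Fin 3 × Fin m) = .inr q := fun h1 h2 =>
    congrArg _ (Prod.ext h1 (Fin.ext h2))
  -- A vertex of `K` has at most one pendant neighbour.
  have hone : ∀ {y : A} {p q : Fin 3 × Fin m}, (attachPaths K τ m).Adj (.inl y) (.inr p) →
      (attachPaths K τ m).Adj (.inl y) (.inr q) →
      (Sum.inr p : A ⊕ Fin 3 × Fin m) = .inr q := fun hp hq =>
    hext (hτ (hp.1.symm.trans hq.1)) (hp.2.trans hq.2.symm)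
  obtain x | p := x
  · have hs : ∀ {p : Fin 3 × Fin m} {y z : A}, (attachPaths K τ m).Adj (.inl x) (.inr p) →
        K.Adj x y → K.Adj x z → (Sum.inl y : A ⊕ Fin 3 × Fin m) ≠ .inl z → K.Adj y z :=
      fun {p y z} hp hy hz hyz => by
        obtain rfl := hp.1
        exact hsimp _ y hy z hz (fun h => hyz (congrArg _ h))
    obtain a | a := a <;> obtain b | b := b <;> obtain c | c := c
    · exact hclaw x a ha b hb (fun h => hab (congrArg _ h)) c hc (fun h => hac (congrArg _ h))
        (fun h => hbc (congrArg _ h))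
    · exact Or.inl (hs hc ha hb hab)
    · exact Or.inr (Or.inl (hs hb ha hc hac))
    · exact absurd (hone hb hc) hbc
    · exact Or.inr (Or.inr (hs ha hb hc hbc))
    · exact absurd (hone ha hc) hac
    · exact absurd (hone ha hb) hab
    · exact absurd (hone ha hb) hab
  · -- A pendant vertex has at most two neighbours.
    exfalso
    obtain a | a := a <;> obtain b | b := b <;> obtain c | c := c <;>
      simp only [attachPaths_adj_inr_inl, attachPaths_adj_inr_inr] at ha hb hc
    · exact hab (congrArg _ (ha.1.trans hb.1.symm))
    · exact hab (congrArg _ (ha.1.trans hb.1.symm))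
    · exact hac (congrArg _ (ha.1.trans hc.1.symm))
    · exact hbc (hext (hb.1.symm.trans hc.1) (by omega))
    · exact hbc (congrArg _ (hb.1.trans hc.1.symm))
    · exact hac (hext (ha.1.symm.trans hc.1) (by omega))
    · exact hab (hext (ha.1.symm.trans hb.1) (by omega))
    · have h1 : a.2.val ≠ b.2.val := fun h => hab (hext (ha.1.symm.trans hb.1) h)
      have h2 : a.2.val ≠ c.2.val := fun h => hac (hext (ha.1.symm.trans hc.1) h)
      have h3 : b.2.val ≠ c.2.val := fun h => hbc (hext (hb.1.symm.trans hc.1) h)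
      omega

end Pendants

/-! ### Fixers and linear forests -/

theorem IsPathList.map_iso {V : Type u} {W : Type v} {G : SimpleGraph V} {G' : SimpleGraph W}
    (e : G ≃g G') {l : List V} (hl : IsPathList G l) : IsPathList G' (l.map e) := by
  refine ⟨?_, hl.2.map e.injective⟩
  rw [List.isChain_map]
  exact hl.1.imp fun a b h => e.map_rel_iff.2 h

theorem IsLongestList.map_iso {V : Type u} {W : Type v} {G : SimpleGraph V} {G' : SimpleGraph W}
    (e : G ≃g G') {l : List V} (hl : IsLongestList G l) : IsLongestList G' (l.map e) :=
  ⟨hl.1.map_iso e, fun l' hl' => by simpa using hl.2 _ (hl'.map_iso e.symm)⟩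

theorem IsLongestList.not_isGallaiVertex {V : Type u} {G : SimpleGraph V} {l : List V}
    (hl : IsLongestList G l) {x : V} (hx : x ∉ l) : ¬ IsGallaiVertex G x := by
  have : Nonempty V := ⟨x⟩
  intro hG
  have hsupp := SimpleGraph.Walk.support_ofSupport hl.ne_nil hl.1.1
  have hlen := (SimpleGraph.Walk.ofSupport l hl.ne_nil hl.1.1).length_support
  rw [hsupp] at hlen
  obtain ⟨y, rfl, hy⟩ := hG _ _ (SimpleGraph.Walk.ofSupport l hl.ne_nil hl.1.1)
    ⟨by rw [SimpleGraph.Walk.isPath_def, hsupp]; exact hl.1.2, fun c d q hq => by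
      have := hl.2 q.support ⟨q.isChain_adj_support, hq.support_nodup⟩
      rw [q.length_support] at this
      omega⟩
  rw [hsupp] at hy
  exact hx hy

/-- A counterexample in `Type` refutes `IsFixer` in every universe. -/
theorem not_isFixer_of_forall_exists_notMem {V : Type u} {H : SimpleGraph V} {W : Type} [Finite W]
    {G : SimpleGraph W} (hconn : G.Connected) (hfree : IsInducedFree H G)
    (hG : ∀ x, ∃ l, IsLongestList G l ∧ x ∉ l) : ¬ IsFixer.{u, v} H := by
  intro hfix
  let e : G.comap Equiv.ulift.{v} ≃g G := SimpleGraph.Iso.comap Equiv.ulift G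
  obtain ⟨x, hx⟩ := hfix (ULift.{v} W) (G.comap Equiv.ulift) (e.connected_iff.2 hconn)
    (fun h => hfree (h.trans ⟨e.toEmbedding⟩))
  obtain ⟨l, hl, hxl⟩ := hG (e x)
  refine (hl.map_iso e.symm).not_isGallaiVertex (fun h => hxl ?_) hx
  obtain ⟨y, hy, rfl⟩ := List.mem_map.1 h
  simpa using hy

/-- Graphs with a triangle or a 4-cycle do not embed in the Petersen graph with one vertex split
into three leaves; triangle-free graphs with a claw do not embed in a claw-free graph. -/
theorem HasObstruction.not_isFixer {V : Type u} {H : SimpleGraph V} (h : HasObstruction H) :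
    ¬ IsFixer.{u, v} H := by
  have hpet : (H.IsIndContained (attachPaths petersenCore petersenTerminal 1) → False) →
      ¬ IsFixer.{u, v} H := fun hfree =>
    not_isFixer_of_forall_exists_notMem (connected_attachPaths connected_petersenCore) hfree
      (isGallaiCore_petersenCore.exists_isLongestList_notMem (by simp))
  have htri : ∀ {a b c}, H.Adj a b → H.Adj b c → H.Adj c a → ¬ IsFixer.{u, v} H :=
    fun hab hbc hca => hpet fun ⟨f⟩ => attachPaths_one_triangle_free petersenCore_triangle_free
      (f.map_adj_iff.2 hab) (f.map_adj_iff.2 hbc) (f.map_adj_iff.2 hca)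
  cases h with
  | triangle hab hbc hca => exact htri hab hbc hca
  | fourCycle hab hbc hcd hda hac hbd =>
    exact hpet fun ⟨f⟩ => attachPaths_one_fourCycle_free petersenCore_fourCycle_free
      (f.map_adj_iff.2 hab) (f.map_adj_iff.2 hbc) (f.map_adj_iff.2 hcd) (f.map_adj_iff.2 hda)
      (f.injective.ne hac) (f.injective.ne hbd)
  | @claw a b c d hab hac had hbc hbd hcd =>
    by_cases hT : H.Adj b c ∨ H.Adj b d ∨ H.Adj c d
    · obtain h | h | h := hT
      exacts [htri hab h hac.symm, htri hab h had.symm, htri hac h had.symm]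
    · refine not_isFixer_of_forall_exists_notMem
        (connected_attachPaths (m := 4) connected_inflatedCore) ?_
        (isGallaiCore_inflatedCore.exists_isLongestList_notMem (by simp))
      rintro ⟨f⟩
      refine hT ?_
      have := attachPaths_claw_free (by decide) inflatedCore_claw_free inflatedCore_simplicial
        (f.map_adj_iff.2 hab) (f.map_adj_iff.2 hac) (f.map_adj_iff.2 had) (f.injective.ne hbc)
        (f.injective.ne hbd) (f.injective.ne hcd)
      simpa only [f.map_adj_iff] using this

theorem isFixer_of_not_hasObstruction {V : Type u} [Finite V] {H : SimpleGraph V}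
    (hV : Nat.card V ≤ 4) (h : ¬ HasObstruction H) : IsFixer.{u, v} H := by
  classical
  have : Fintype V := Fintype.ofFinite V
  rw [Nat.card_eq_fintype_card] at hV
  intro W _ G hG hfree
  by_contra! hcon
  obtain ⟨f⟩ : Nonempty (V ↪ Fin 4) := Function.Embedding.nonempty_of_card_le (by simpa using hV)
  obtain ⟨a, b, c, d, hab, hac, had, hbc, hbd, hcd, nac, nad, nbd⟩ :=
    exists_order_of_not_hasObstruction (fun h' => h (h'.of_map f))
  obtain ⟨a', b', c', d', hab', hac', had', hbc', hbd', hcd', nac', nad', nbd', iab, ibc, icd⟩ :=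
    exists_subpath_of_forall_not_isGallaiVertex hG hcon ((H.map f).Adj a b) ((H.map f).Adj b c)
      ((H.map f).Adj c d)
  have hall : ∀ x, x = a ∨ x = b ∨ x = c ∨ x = d := by omega
  let g : Fin 4 → W := fun x => if x = a then a' else if x = b then b' else if x = c then c' else d'
  have ga : g a = a' := by simp [g]
  have gb : g b = b' := by simp [g, hab.symm]
  have gc : g c = c' := by simp [g, hac.symm, hbc.symm]
  have gd : g d = d' := by simp [g, had.symm, hbd.symm, hcd.symm]
  have hinj : Function.Injective g := by
    intro x y hxy
    obtain rfl | rfl | rfl | rfl := hall x <;> obtain rfl | rfl | rfl | rfl := hall y <;>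
      simp_all
  have hadj : ∀ x y, G.Adj (g x) (g y) ↔ (H.map f).Adj x y := by
    intro x y
    obtain rfl | rfl | rfl | rfl := hall x <;> obtain rfl | rfl | rfl | rfl := hall y <;>
      simp only [ga, gb, gc, gd] <;> grind [SimpleGraph.adj_comm, SimpleGraph.irrefl]
  exact hfree (SimpleGraph.IsIndContained.trans ⟨SimpleGraph.Embedding.map f H⟩
    ⟨⟨⟨g, hinj⟩, fun {x y} => hadj x y⟩⟩)

end GallaiPaths

theorem mainTheorem4 {V : Type u} [Finite V] (H : SimpleGraph V) (hV : Nat.card V ≤ 4) :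
    GallaiPaths.IsFixer.{u, v} H ↔ GallaiPaths.IsLinearForest H := by
  refine ⟨fun hfix => ?_, fun hH => ?_⟩
  · exact GallaiPaths.isLinearForest_of_not_hasObstruction hV fun h => h.not_isFixer hfix
  · exact GallaiPaths.isFixer_of_not_hasObstruction hV hH.not_hasObstruction
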